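/- **Theorem 1.4.** A Lie algebra means a Lie algebra over an arbitrary commutative ring with unity. Let $A$ be an additively written abelian group. A Lie algebra $L$ is $A$-graded if $L=\bigoplus_{a\in A}L_a$ for submodules $L_a$ with $[L_a,L_b]\subseteq L_{a+b}$ for all $a,b\in A$; for a subgroup $B\le A$ let $L_B=\bigoplus_{a\in B}L_a$, a subalgebra of $L$. A *double automorphism* of $L$ is an automorphism $\phi$ of the Lie algebra $L$ that induces an automorphism of $A$, i.e. for which there is an automorphism $a\mapsto a^{\phi}$ of the group $A$ with $\phi(L_a)=L_{a^{\phi}}$ for all $a\in A$. We write $C_A(\phi)=0$ if such an induced automorphism of $A$ can be chosen so that $0$ is its only fixed point (it is uniquely determined if $L_a\neq 0$ for all $a\ne 0$). For a group $H$ of automorphisms of $L$, $C_L(H)$ denotes the subalgebra of the elements of $L$ fixed by all of $H$. There exist functions $P(c,q)$ and $N(c,q)$ of non-negative integers $c,q$ with the following property. Let $p$ be a prime, let $A$ be an elementary abelian group of order $p^2$, and let $L$ be an $A$-graded Lie algebra such that $L_B$ is nilpotent of class at most $c$ for every proper subgroup $B<A$. Assume that $H$ is a finite group of double automorphisms of $L$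 such that $C_A(h)=0$ for all nontrivial $h\in H$ and $C_L(H)$ is nilpotent of class at most $c$. If $p\ge P(c,|H|)$, then $L$ is nilpotent of class at most $N(c,|H|)$. -/

import Mathlib

namespace GradedLie

variable {R L A : Type*} [CommRing R] [LieRing L] [LieAlgebra R L]

/-- The group `Aut L` of automorphisms of a Lie algebra under composition,
`(φ * ψ) x = φ (ψ x)`. -/
instance autGroup : Group (L ≃ₗ⁅R⁆ L) where
  mul φ ψ := ψ.trans φ
  one := 1
  inv φ := φ.symm
  mul_assoc _ _ _ := rfl
  one_mul _ := rfl
  mul_one _ := rfl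
  inv_mul_cancel φ := φ.self_trans_symm

theorem mul_apply (φ ψ : L ≃ₗ⁅R⁆ L) (x : L) : (φ * ψ) x = φ (ψ x) := rfl

theorem inv_apply_self (φ : L ≃ₗ⁅R⁆ L) (x : L) : φ⁻¹ (φ x) = x := φ.symm_apply_apply x

/-- The Lie algebra `K` is nilpotent of class at most `c`: the `(c + 1)`-st term of its lower
central series vanishes (Mathlib numbers the terms from `0`). -/
def NilpotentClassLE (R K : Type*) [CommRing R] [LieRing K] [LieAlgebra R K] (c : ℕ) : Prop :=
  LieModule.lowerCentralSeries R K K c = ⊥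

/-- `C_L(H)`, the subalgebra of all elements of `L` fixed by every element of `H`. -/
def fixedPoints (H : Subgroup (L ≃ₗ⁅R⁆ L)) : LieSubalgebra R L where
  carrier := {x | ∀ φ ∈ H, φ x = x}
  add_mem' hx hy φ hφ := by rw [map_add, hx φ hφ, hy φ hφ]
  zero_mem' φ _ := map_zero φ
  smul_mem' r x hx φ hφ := by rw [map_smul, hx φ hφ]
  lie_mem' {x y} hx hy φ hφ := by
    have h := LieHom.map_lie (φ : L →ₗ⁅R⁆ L) x y
    simp only [LieEquiv.coe_toLieHom] at h
    rw [h, hx φ hφ, hy φ hφ]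

variable [AddCommGroup A]

/-- `L_B`, the subalgebra `⨁_{b ∈ B} L_b` of an `A`-graded Lie algebra, for `B` a subgroup
of `A`. -/
def part (ℒ : A → Submodule R L) [SetLike.GradedBracket ℒ] (B : AddSubgroup A) :
    LieSubalgebra R L where
  toSubmodule := ⨆ b : B, ℒ b
  lie_mem' {x y} hx hy := by
    change x ∈ ⨆ b : B, ℒ b at hx
    change y ∈ ⨆ b : B, ℒ b at hy
    change ⁅x, y⁆ ∈ ⨆ b : B, ℒ b
    induction hx using Submodule.iSup_induction' with
    | zero => simp
    | add x₁ x₂ _ _ h₁ h₂ => rw [add_lie]; exact add_mem h₁ h₂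
    | mem a x hx =>
      induction hy using Submodule.iSup_induction' with
      | zero => simp
      | add y₁ y₂ _ _ h₁ h₂ => rw [lie_add]; exact add_mem h₁ h₂
      | mem b y hy =>
        exact Submodule.mem_iSup_of_mem (p := fun b : B => ℒ b) (a + b)
          (SetLike.GradedBracket.bracket_mem hx hy)

/-- The automorphism `φ` of `L` permutes the grading components as the automorphism `σ` of `A`
permutes their degrees: `φ(L_a) = L_{σ(a)}` for all `a`. -/
def Induces (ℒ : A → Submodule R L) (φ : L ≃ₗ⁅R⁆ L) (σ : A ≃+ A) : Prop :=
  ∀ a, (ℒ a).map (φ.toLinearEquiv : L →ₗ[R] L) = ℒ (σ a)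

/-- An automorphism of `L` is a double automorphism if it induces an automorphism of `A`. -/
def IsDoubleAut (ℒ : A → Submodule R L) (φ : L ≃ₗ⁅R⁆ L) : Prop :=
  ∃ σ : A ≃+ A, Induces ℒ φ σ

/-- `C_A(φ) = 0` for a double automorphism `φ`: it acts on the degrees by an automorphism of `A`
whose only fixed point is `0`. (If all `L_a` with `a ≠ 0` are nonzero, the induced automorphism
is unique.) -/
def ActsFreely (ℒ : A → Submodule R L) (φ : L ≃ₗ⁅R⁆ L) : Prop :=
  ∃ σ : A ≃+ A, Induces ℒ φ σ ∧ ∀ a, σ a = a → a = 0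

end GradedLie

/-! Write q = |H| and a^h for the induced action on degrees. Call a sequence of degrees independent
if replacing its members a by a^h never preserves the sum unless every h is trivial. Replace the
entries of a homogeneous commutator by their H-orbit sums: the result is a commutator in C_L(H), so
with c + 1 entries it is zero. For independent degrees the original commutator is the only summand
of its degree, hence it vanishes too: L is "selectively c-nilpotent" (`selective_of_fixedPoints`).

An independent sequence stays independent after adding any degree outside a set of bounded size
(`exists_finset_indep_cons`), and for large p so is any repetition b, ..., b with b ≠ 0 and L_b ≠ 0
(`indep_replicate`). Together these make every such L_b act nilpotently on L with bounded index; for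
L_0 this comes from the nilpotency of L_B with B cyclic.

Now induct on the selective class m + 1 (`brPow_eq_bot_of_selective`). The span of the commutators
with a given independent sequence of m + 1 degrees is centralized by all but boundedly many
components. Collecting letters shows that only boundedly many components act nontrivially on the
ideal it generates (`exists_finset_forall_br_word_eq_bot`). A functional A → ℤ/p nonzero on the
nonzero degrees among these turns the action into a ℤ/p-graded algebra with few components and
nilpotent zero component, soluble by Kreknin's argument (`iterate_der_eq_bot`). A soluble algebra
with few components, each acting nilpotently, acts nilpotently (`brPow_eq_bot_of_iterate_der`). So L
acts nilpotently on the sum of all these ideals, and the quotient is selectively m-nilpotent. -/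

namespace GradedLie

/-! ### Spans of iterated brackets, and reordering of words. -/

section Bracket

variable {R L M ι : Type*} [CommRing R] [LieRing L] [LieAlgebra R L]
  [AddCommGroup M] [Module R M] [LieRingModule L M] [LieModule R L M]

/-- The span of all brackets `⁅x, n⁆` with `x ∈ P` and `n ∈ N`. -/
def br (P : Submodule R L) (N : Submodule R M) : Submodule R M :=
  Submodule.map₂ (LieModule.toEnd R L M : L →ₗ[R] M →ₗ[R] M) P N

theorem br_le {P : Submodule R L} {N Q : Submodule R M} :
    br P N ≤ Q ↔ ∀ x ∈ P, ∀ n ∈ N, ⁅x, n⁆ ∈ Q :=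
  Submodule.map₂_le

theorem lie_mem_br {P : Submodule R L} {N : Submodule R M} {x : L} {n : M} (hx : x ∈ P)
    (hn : n ∈ N) : ⁅x, n⁆ ∈ br P N :=
  br_le.1 le_rfl x hx n hn

theorem br_induction {P : Submodule R L} {N : Submodule R M}
    {C : M → Prop} {y : M} (hy : y ∈ br P N) (lie : ∀ x ∈ P, ∀ n ∈ N, C ⁅x, n⁆)
    (add : ∀ m n, C m → C n → C (m + n)) : C y := by
  refine Submodule.iSup_induction _ (motive := C) hy ?_ ?_ add
  · rintro ⟨x, hx⟩ _ ⟨n, hn, rfl⟩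
    exact lie x hx n hn
  · have := lie 0 (zero_mem _) 0 (zero_mem _)
    rwa [lie_zero] at this

theorem br_mono {P P' : Submodule R L} {N N' : Submodule R M} (h : P ≤ P') (h' : N ≤ N') :
    br P N ≤ br P' N' :=
  Submodule.map₂_le_map₂ h h'

theorem br_sup_right (P : Submodule R L) (N N' : Submodule R M) :
    br P (N ⊔ N') = br P N ⊔ br P N' :=
  Submodule.map₂_sup_right _ _ _ _

theorem br_iSup_right {κ : Sort*} (P : Submodule R L) (N : κ → Submodule R M) :
    br P (⨆ k, N k) = ⨆ k, br P (N k) :=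
  Submodule.map₂_iSup_right _ _ _

theorem br_iSup_left {κ : Sort*} (P : κ → Submodule R L) (N : Submodule R M) :
    br (⨆ k, P k) N = ⨆ k, br (P k) N :=
  Submodule.map₂_iSup_left _ _ _

@[simp] theorem br_bot_right (P : Submodule R L) : br P (⊥ : Submodule R M) = ⊥ :=
  Submodule.map₂_bot_right _ _

@[simp] theorem br_bot_left (N : Submodule R M) : br (⊥ : Submodule R L) N = ⊥ :=
  Submodule.map₂_bot_left _ _

theorem br_br_le (P Q : Submodule R L) (N : Submodule R M) :
    br P (br Q N) ≤ br Q (br P N) ⊔ br (br P Q) N := by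
  refine br_le.2 fun x hx n hn => ?_
  have : br Q N ≤ (br Q (br P N) ⊔ br (br P Q) N).comap (LieModule.toEnd R L M x) := by
    refine br_le.2 fun y hy n hn => ?_
    rw [Submodule.mem_comap, LieModule.toEnd_apply_apply, leibniz_lie, add_comm]
    exact Submodule.add_mem_sup (lie_mem_br hy (lie_mem_br hx hn))
      (lie_mem_br (lie_mem_br hx hy) hn)
  exact this hn

theorem br_comm (P Q : Submodule R L) : br P Q = br Q P := by
  have key : ∀ P Q : Submodule R L, br P Q ≤ br Q P := fun P Q => br_le.2 fun x hx y hy => by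
    rw [← lie_skew]
    exact neg_mem (lie_mem_br hy hx)
  exact le_antisymm (key P Q) (key Q P)

theorem map_br {L' : Type*} [LieRing L'] [LieAlgebra R L'] (φ : L →ₗ⁅R⁆ L')
    (P Q : Submodule R L) :
    (br P Q).map (φ : L →ₗ[R] L') = br (P.map (φ : L →ₗ[R] L')) (Q.map (φ : L →ₗ[R] L')) := by
  apply le_antisymm
  · rw [Submodule.map_le_iff_le_comap]
    refine br_le.2 fun x hx y hy => ?_
    rw [Submodule.mem_comap, LieHom.coe_toLinearMap, LieHom.map_lie]
    exact lie_mem_br (Submodule.mem_map_of_mem (f := (φ : L →ₗ[R] L')) hx)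
      (Submodule.mem_map_of_mem (f := (φ : L →ₗ[R] L')) hy)
  · refine br_le.2 ?_
    rintro _ ⟨x, hx, rfl⟩ _ ⟨y, hy, rfl⟩
    exact ⟨_, lie_mem_br hx hy, by simp⟩

/-- The span of the brackets `⁅x₁, ⁅x₂, …, ⁅xₖ, n⁆⁆⁆` with `xᵢ ∈ F aᵢ` and `n ∈ N`, where
`l = [a₁, …, aₖ]`. -/
def word (F : ι → Submodule R L) (l : List ι) (N : Submodule R M) : Submodule R M :=
  l.foldr (fun a N => br (F a) N) N

@[simp] theorem word_nil (F : ι → Submodule R L) (N : Submodule R M) : word F [] N = N := rfl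

@[simp] theorem word_cons (F : ι → Submodule R L) (a : ι) (l : List ι) (N : Submodule R M) :
    word F (a :: l) N = br (F a) (word F l N) := rfl

theorem word_append (F : ι → Submodule R L) (l l' : List ι) (N : Submodule R M) :
    word F (l ++ l') N = word F l (word F l' N) := by
  simp [word]

@[simp] theorem word_bot (F : ι → Submodule R L) (l : List ι) :
    word F l (⊥ : Submodule R M) = ⊥ := by
  induction l with
  | nil => rfl
  | cons a l ih => rw [word_cons, ih, br_bot_right]

theorem map_word {L' : Type*} [LieRing L'] [LieAlgebra R L'] (φ : L →ₗ⁅R⁆ L')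
    (F : ι → Submodule R L) (l : List ι) (N : Submodule R L) :
    (word F l N).map (φ : L →ₗ[R] L') =
      word (fun a => (F a).map (φ : L →ₗ[R] L')) l (N.map (φ : L →ₗ[R] L')) := by
  induction l with
  | nil => rfl
  | cons a l ih => rw [word_cons, map_br, ih, word_cons]

/-- `k`-fold bracketing with `P`. -/
def brPow (P : Submodule R L) (k : ℕ) (N : Submodule R M) : Submodule R M :=
  (br P)^[k] N

@[simp] theorem brPow_zero (P : Submodule R L) (N : Submodule R M) : brPow P 0 N = N := rfl

theorem brPow_succ (P : Submodule R L) (k : ℕ) (N : Submodule R M) :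
    brPow P (k + 1) N = br P (brPow P k N) :=
  Function.iterate_succ_apply' _ _ _

theorem brPow_add (P : Submodule R L) (k k' : ℕ) (N : Submodule R M) :
    brPow P (k + k') N = brPow P k (brPow P k' N) :=
  Function.iterate_add_apply _ _ _ _

theorem brPow_mono {P P' : Submodule R L} (h : P ≤ P') (k : ℕ) {N N' : Submodule R M}
    (h' : N ≤ N') : brPow P k N ≤ brPow P' k N' := by
  induction k with
  | zero => exact h'
  | succ k ih => rw [brPow_succ, brPow_succ]; exact br_mono h ih

theorem brPow_bot_right (P : Submodule R L) (k : ℕ) : brPow P k (⊥ : Submodule R M) = ⊥ := by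
  induction k with
  | zero => rfl
  | succ k ih => rw [brPow_succ, ih, br_bot_right]

theorem brPow_iSup_right {κ : Sort*} (P : Submodule R L) (k : ℕ) (N : κ → Submodule R M) :
    brPow P k (⨆ i, N i) = ⨆ i, brPow P k (N i) := by
  induction k with
  | zero => rfl
  | succ k ih => simp only [brPow_succ, ih, br_iSup_right]

theorem word_replicate (F : ι → Submodule R L) (a : ι) (k : ℕ) (N : Submodule R M) :
    word F (List.replicate k a) N = brPow (F a) k N := by
  induction k with
  | zero => rfl
  | succ k ih => rw [List.replicate_succ, word_cons, ih, brPow_succ]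

theorem map_brPow {L' : Type*} [LieRing L'] [LieAlgebra R L'] (φ : L →ₗ⁅R⁆ L')
    (P N : Submodule R L) (k : ℕ) :
    (brPow P k N).map (φ : L →ₗ[R] L') =
      brPow (P.map (φ : L →ₗ[R] L')) k (N.map (φ : L →ₗ[R] L')) := by
  induction k with
  | zero => rfl
  | succ k ih => rw [brPow_succ, map_br, ih, brPow_succ]

theorem brPow_iSup_left (F : ι → Submodule R L) (k : ℕ) (N : Submodule R M) :
    brPow (⨆ a, F a) k N = ⨆ l : {l : List ι // l.length = k}, word F l.1 N := by
  induction k with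
  | zero =>
    apply le_antisymm
    · exact le_iSup_of_le ⟨[], rfl⟩ le_rfl
    · refine iSup_le ?_
      rintro ⟨l, hl⟩
      obtain rfl := List.eq_nil_of_length_eq_zero hl
      exact le_rfl
  | succ k ih =>
    rw [brPow_succ, ih, br_iSup_left]
    apply le_antisymm
    · refine iSup_le fun a => ?_
      rw [br_iSup_right]
      exact iSup_le fun l => le_iSup_of_le ⟨a :: l.1, by simp [l.2]⟩ le_rfl
    · refine iSup_le ?_
      rintro ⟨_ | ⟨a, l⟩, hl⟩
      · simp at hl
      · refine le_iSup_of_le a ?_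
        rw [br_iSup_right]
        exact le_iSup_of_le ⟨l, by simpa using hl⟩ le_rfl

/-- Permuting the letters of a word changes it only by words with a bracket of two letters
in place of these letters; `Z n s` bounds the words obtained from words of length `n` and
degree `s`. -/
theorem word_perm_le [AddCommMonoid ι] {F : ι → Submodule R L} {N : Submodule R M}
    {Z : ℕ → ι → Submodule R M} (hZ : ∀ a n s, br (F a) (Z n s) ≤ Z (n + 1) (a + s))
    (hN : ∀ a b l, br (br (F a) (F b)) (word F l N) ≤ Z (l.length + 2) (a + (b + l.sum)))
    {l l' : List ι} (h : l.Perm l') :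
    word F l N ≤ word F l' N ⊔ Z l.length l.sum := by
  induction h with
  | nil => exact le_sup_left
  | cons a _ ih =>
    refine (br_mono le_rfl ih).trans ?_
    rw [br_sup_right]
    exact sup_le_sup_left (by simpa using hZ _ _ _) _
  | swap a b l =>
    refine (br_br_le _ _ _).trans (sup_le_sup_left ?_ _)
    exact hN b a l
  | trans h₁ _ ih₁ ih₂ =>
    refine ih₁.trans (sup_le (ih₂.trans ?_) le_sup_right)
    rw [h₁.length_eq, h₁.sum_eq]

end Bracket

/-- A long list of elements of a finite set has a letter repeated `K` times. -/
theorem exists_perm_append_replicate {ι : Type*} [DecidableEq ι] (D : Finset ι) (K : ℕ)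
    (l : List ι) (hl : ∀ a ∈ l, a ∈ D) (hlen : D.card * K < l.length) :
    ∃ a ∈ D, ∃ l', l.Perm (l' ++ List.replicate K a) := by
  have hcard : (∑ a ∈ D, l.count a) = l.length := by
    have := Multiset.sum_count_eq_card (s := D) (m := (l : Multiset ι)) (by simpa using hl)
    simpa using this
  obtain ⟨a, ha, hK⟩ : ∃ a ∈ D, K ≤ l.count a := by
    by_contra! hcon
    have := Finset.sum_le_card_nsmul D (fun a => l.count a) K fun a ha => (hcon a ha).le
    rw [hcard, smul_eq_mul] at this
    omega
  have hsub : (List.replicate K a).Subperm l := (List.replicate_sublist_iff.2 hK).subperm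
  obtain ⟨l', hl'⟩ := Multiset.le_iff_exists_add.1 (Multiset.coe_le.2 hsub)
  refine ⟨a, ha, l'.toList, ?_⟩
  rw [← Multiset.coe_eq_coe, hl', ← Multiset.coe_add, Multiset.coe_toList, add_comm]

/-! ### Derived series and generated subalgebras, degree by degree. -/

section Derived

variable {R L A : Type*} [CommRing R] [LieRing L] [LieAlgebra R L] [AddCommGroup A]

/-- A family of submodules indexed by `A` whose brackets respect the degrees. -/
def Closed (F : A → Submodule R L) : Prop :=
  ∀ a b, br (F a) (F b) ≤ F (a + b)

/-- The homogeneous components of the derived algebra of a graded Lie algebra. -/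
def der (F : A → Submodule R L) (a : A) : Submodule R L :=
  ⨆ b, br (F b) (F (a - b))

theorem der_mono {F G : A → Submodule R L} (h : F ≤ G) : der F ≤ der G :=
  fun _ => iSup_mono fun _ => br_mono (h _) (h _)

theorem br_le_der (F : A → Submodule R L) (a b : A) : br (F a) (F b) ≤ der F (a + b) :=
  le_iSup_of_le a (by rw [add_sub_cancel_left])

theorem Closed.der_le {F : A → Submodule R L} (hF : Closed F) : der F ≤ F :=
  fun a => iSup_le fun b => (hF _ _).trans_eq (by rw [add_sub_cancel])

theorem Closed.der {F : A → Submodule R L} (hF : Closed F) : Closed (der F) :=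
  fun _ _ => (br_mono (hF.der_le _) (hF.der_le _)).trans (br_le_der _ _ _)

theorem Closed.iterate_der {F : A → Submodule R L} (hF : Closed F) (n : ℕ) :
    Closed (GradedLie.der^[n] F) := by
  induction n with
  | zero => exact hF
  | succ n ih => rw [Function.iterate_succ_apply']; exact ih.der

theorem Closed.iterate_der_le {F : A → Submodule R L} (hF : Closed F) (n : ℕ) :
    GradedLie.der^[n] F ≤ F := by
  induction n with
  | zero => exact le_rfl
  | succ n ih =>
    rw [Function.iterate_succ_apply']
    exact (hF.iterate_der n).der_le.trans ih

theorem map_iterate_der {L' : Type*} [LieRing L'] [LieAlgebra R L'] (φ : L →ₗ⁅R⁆ L')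
    (F : A → Submodule R L) (n : ℕ) (a : A) :
    (der^[n] F a).map (φ : L →ₗ[R] L') = der^[n] (fun a => (F a).map (φ : L →ₗ[R] L')) a := by
  induction n generalizing a with
  | zero => rfl
  | succ n ih =>
    simp only [Function.iterate_succ_apply', der, Submodule.map_iSup, map_br, ih]

theorem Closed.map {L' : Type*} [LieRing L'] [LieAlgebra R L'] (φ : L →ₗ⁅R⁆ L')
    {F : A → Submodule R L} (hF : Closed F) :
    Closed (fun a => (F a).map (φ : L →ₗ[R] L')) := fun a b => by
  rw [← map_br]
  exact Submodule.map_mono (hF a b)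

/-- The homogeneous components of the subalgebra generated by the components `F i` with
`i ∈ S`. -/
def gen (S : Set A) (F : A → Submodule R L) (a : A) : Submodule R L :=
  ⨅ G : {G : A → Submodule R L // Closed G ∧ ∀ i ∈ S, F i ≤ G i}, G.1 a

theorem le_gen {S : Set A} (F : A → Submodule R L) {a : A} (ha : a ∈ S) : F a ≤ gen S F a :=
  le_iInf fun G => G.2.2 a ha

theorem gen_le {S : Set A} {F G : A → Submodule R L} (hG : Closed G) (h : ∀ i ∈ S, F i ≤ G i) :
    gen S F ≤ G :=
  fun a => iInf_le (fun G : {G : A → Submodule R L // Closed G ∧ ∀ i ∈ S, F i ≤ G i} => G.1 a)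
    ⟨G, hG, h⟩

theorem closed_gen (S : Set A) (F : A → Submodule R L) : Closed (gen S F) :=
  fun a b => le_iInf fun G =>
    (br_mono (gen_le G.2.1 G.2.2 a) (gen_le G.2.1 G.2.2 b)).trans (G.2.1 a b)

/-- By the Jacobi identity, the homogeneous elements whose brackets with all components satisfy the
bound form a closed family, and this family contains the generators. -/
theorem br_gen_le {S : Set A} {F : A → Submodule R L} (hF : Closed F) (a b : A) :
    br (gen S F a) (F b) ≤ ⨆ s ∈ S, br (F s) (F (a + b - s)) := by
  let Q : A → Submodule R L := fun k => ⨆ s ∈ S, br (F s) (F (k - s))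
  let G : A → Submodule R L := fun j =>
    { carrier := {v | v ∈ F j ∧ ∀ i, ∀ u ∈ F i, ⁅v, u⁆ ∈ Q (j + i)}
      add_mem' := fun hx hy => ⟨add_mem hx.1 hy.1, fun i u hu => by
        rw [add_lie]; exact add_mem (hx.2 i u hu) (hy.2 i u hu)⟩
      zero_mem' := ⟨zero_mem _, fun i u _ => by rw [zero_lie]; exact zero_mem _⟩
      smul_mem' := fun r x hx => ⟨Submodule.smul_mem _ r hx.1, fun i u hu => by
        rw [smul_lie]; exact Submodule.smul_mem _ r (hx.2 i u hu)⟩ }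
  have hG : Closed G := by
    refine fun a b => br_le.2 fun x hx y hy => ⟨hF _ _ (lie_mem_br hx.1 hy.1), fun i u hu => ?_⟩
    rw [lie_lie]
    refine sub_mem ?_ ?_
    · rw [add_assoc]
      exact hx.2 _ _ (hF _ _ (lie_mem_br hy.1 hu))
    · rw [add_comm a b, add_assoc]
      exact hy.2 _ _ (hF _ _ (lie_mem_br hx.1 hu))
  refine br_le.2 fun x hx y hy => (gen_le hG (fun i hi v hv => ?_) a hx).2 b y hy
  refine ⟨hv, fun j u hu => ?_⟩
  refine Submodule.mem_iSup_of_mem i (Submodule.mem_iSup_of_mem hi ?_)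
  rw [add_sub_cancel_left]
  exact lie_mem_br hv hu

end Derived

/-! ### Kreknin's theorem with a bound in terms of the number of nonzero components. -/

section Kreknin

variable {R L : Type*} [CommRing R] [LieRing L] [LieAlgebra R L] {p : ℕ} [NeZero p]

/-- The bound for the derived length of a graded Lie algebra with `n` nonzero components of
nonzero degree on which the zero component acts nilpotently with index `K`. -/
def krekninBound (K : ℕ) : ℕ → ℕ
  | 0 => 0
  | n + 1 => krekninBound K n + K * (krekninBound K n + 1)

/-- Kreknin's elimination of degrees in the order 1, 2, ..., p - 1. A degree whose component is zero
is passed at no cost, so the bound depends on n and not on p. -/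
theorem iterate_der_le_gen (K t : ℕ) : ∀ (n : ℕ) (F : ZMod p → Submodule R L), Closed F →
    (∀ a, brPow (F 0) K (F a) = ⊥) →
    {i : ZMod p | i ≠ 0 ∧ i.val ≤ t ∧ F i ≠ ⊥}.ncard ≤ n →
    der^[krekninBound K n] F ≤ gen {i | i = 0 ∨ t < i.val} F := by
  induction t with
  | zero =>
    intro n F hF _ _
    refine (hF.iterate_der_le _).trans fun a => le_gen F ?_
    by_cases ha : a = 0
    · exact Or.inl ha
    · exact Or.inr (Nat.pos_of_ne_zero fun h => ha ((ZMod.val_eq_zero a).1 h))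
  | succ t ih =>
    intro n F hF hK hn
    by_cases hi : ∃ i : ZMod p, i.val = t + 1 ∧ F i ≠ ⊥
    swap
    · push Not at hi
      refine (ih n F hF hK ((Set.ncard_le_ncard ?_ (Set.toFinite _)).trans hn)).trans
        (gen_le (closed_gen _ _) fun i hit => ?_)
      · exact fun i hi => ⟨hi.1, hi.2.1.trans t.le_succ, hi.2.2⟩
      · rcases hit with h | h
        · exact le_gen F (Or.inl h)
        · rcases (Nat.succ_le_of_lt h).eq_or_lt with h | h
          · rw [hi i h.symm]; exact bot_le
          · exact le_gen F (Or.inr h)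
    obtain ⟨k, hk, hFk⟩ := hi
    have hk0 : k ≠ 0 := by rintro rfl; simp at hk
    obtain ⟨n, rfl⟩ : ∃ m, n = m + 1 := by
      refine ⟨n - 1, (Nat.sub_add_cancel (le_trans ?_ hn)).symm⟩
      exact (Set.ncard_pos (Set.toFinite _)).2 ⟨k, hk0, hk.le, hFk⟩
    have hn' : {i : ZMod p | i ≠ 0 ∧ i.val ≤ t ∧ F i ≠ ⊥}.ncard ≤ n := by
      refine Nat.le_of_lt_succ (lt_of_lt_of_le (Set.ncard_lt_ncard ?_ (Set.toFinite _)) hn)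
      refine ⟨fun i hi => ⟨hi.1, hi.2.1.trans t.le_succ, hi.2.2⟩, fun h => ?_⟩
      have := (h (show k ∈ _ from ⟨hk0, hk.le, hFk⟩)).2.1
      omega
    set r := krekninBound K n with hr
    set Q := gen {i : ZMod p | i = 0 ∨ t + 1 < i.val} F with hQ
    have hQc : Closed Q := closed_gen _ _
    have sub : ∀ G : ZMod p → Submodule R L, Closed G → G ≤ F →
        der^[r] G ≤ gen {i | i = 0 ∨ t < i.val} G := fun G hG hGF => by
      refine ih n G hG (fun a => ?_) ((Set.ncard_le_ncard ?_ (Set.toFinite _)).trans hn')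
      · exact le_bot_iff.1 ((brPow_mono (hGF 0) K (hGF a)).trans (hK a).le)
      · exact fun i hi => ⟨hi.1, hi.2.1, fun h => hi.2.2 (le_bot_iff.1 (h ▸ hGF i))⟩
    -- Each block of r + 1 derivations expresses the component of degree k = t + 1 by elements of
    -- `Q` and one more bracketing with the zero component; after K blocks only `Q` remains.
    have hstep : ∀ m, der^[m * (r + 1)] F k ≤ Q k ⊔ brPow (F 0) m (F k) := by
      intro m
      induction m with
      | zero => simp
      | succ m ihm =>
        set G := der^[m * (r + 1)] F with hG
        have hGc : Closed G := hF.iterate_der _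
        have hGF : G ≤ F := hF.iterate_der_le _
        have h1 : der^[(m + 1) * (r + 1)] F = der (der^[r] G) := by
          rw [hG, ← Function.iterate_succ_apply' (f := der), ← Function.iterate_add_apply]
          rw [Nat.succ_mul, add_comm]
        have h0 : br (G 0) (G k) ≤ Q k ⊔ brPow (F 0) (m + 1) (F k) := by
          refine (br_mono (hGF 0) ihm).trans ?_
          rw [br_sup_right, brPow_succ]
          refine sup_le_sup_right ?_ _
          have := hQc 0 k
          rw [zero_add] at this
          exact (br_mono (le_gen F (Or.inl rfl)) le_rfl).trans this
        rw [h1]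
        refine iSup_le fun b => (br_mono (sub G hGc hGF b)
          (hGc.iterate_der_le r (k - b))).trans ((br_gen_le hGc _ _).trans ?_)
        rw [add_sub_cancel]
        refine iSup₂_le fun s hs => ?_
        by_cases hs0 : s = 0
        · rw [hs0, sub_zero]; exact h0
        by_cases hsk : s = k
        · rw [hsk, sub_self, br_comm]; exact h0
        have hst : t < s.val := hs.resolve_left hs0
        have hst' : t + 1 < s.val := by
          rcases (Nat.succ_le_of_lt hst).eq_or_lt with h | h
          · exact absurd (ZMod.val_injective p (h.symm.trans hk.symm)) hsk
          · exact h
        -- The representative of k - s wraps around to k - s + p, which exceeds k because s < p.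
        have hks : t + 1 < (k - s).val := by
          have hadd := ZMod.val_add s (k - s)
          rw [add_sub_cancel, hk] at hadd
          have h2 := ZMod.val_lt (k - s)
          by_contra! hcon
          rcases lt_or_ge (s.val + (k - s).val) p with h3 | h3
          · rw [Nat.mod_eq_of_lt h3] at hadd
            omega
          · have h4 := ZMod.val_lt s
            have h5 : s.val + (k - s).val = p + (s.val + (k - s).val - p) := by omega
            rw [h5, Nat.add_mod_left, Nat.mod_eq_of_lt (by omega)] at hadd
            omega
        refine le_sup_of_le_left ((br_mono ((hGF s).trans (le_gen F (Or.inr hst')))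
          ((hGF _).trans (le_gen F (Or.inr hks)))).trans ((hQc _ _).trans_eq ?_))
        rw [add_sub_cancel]
    have hKk := hstep K
    rw [hK k, sup_bot_eq] at hKk
    have hGF : der^[K * (r + 1)] F ≤ F := hF.iterate_der_le _
    rw [krekninBound, ← hr, Function.iterate_add_apply]
    refine (sub _ (hF.iterate_der _) hGF).trans (gen_le hQc fun i hi => ?_)
    rcases hi with h | h
    · exact (hGF i).trans (le_gen F (Or.inl h))
    · rcases (Nat.succ_le_of_lt h).eq_or_lt with h | h
      · obtain rfl : k = i := ZMod.val_injective p (hk.trans h)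
        exact hKk
      · exact (hGF i).trans (le_gen F (Or.inr h))

/-- A version of Kreknin's theorem: a `ℤ/pℤ`-graded Lie algebra with few nonzero components on
which the zero component acts nilpotently is soluble of bounded derived length. -/
theorem iterate_der_eq_bot {K n : ℕ} {F : ZMod p → Submodule R L} (hF : Closed F)
    (hK : ∀ a, brPow (F 0) K (F a) = ⊥) (hn : {i : ZMod p | F i ≠ ⊥}.ncard ≤ n) :
    der^[K + krekninBound K n] F = ⊥ := by
  have h1 : der^[krekninBound K n] F ≤ fun i => if i = 0 then F 0 else ⊥ := by
    refine (iterate_der_le_gen K p n F hF hK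
      ((Set.ncard_le_ncard (fun i hi => hi.2.2) (Set.toFinite _)).trans hn)).trans
      (gen_le (fun a b => ?_) fun i hi => ?_)
    · by_cases ha : a = 0
      · by_cases hb : b = 0
        · subst ha hb; simpa using hF 0 0
        · simp [hb]
      · simp [ha]
    · rcases hi with rfl | h
      · simp
      · exact absurd (ZMod.val_lt i) h.not_gt
  -- Once everything is concentrated in degree 0, each further derivation adds a bracketing with `F
  -- 0`.
  have h2 : ∀ m, der^[m + krekninBound K n] F ≤ fun i => if i = 0 then brPow (F 0) m (F 0) else ⊥ := by
    intro m
    induction m with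
    | zero => simpa using h1
    | succ m ih =>
      rw [Nat.succ_add, Function.iterate_succ_apply']
      refine (der_mono (le_inf ih (hF.iterate_der_le _))).trans fun i => iSup_le fun b => ?_
      by_cases hb : b = 0
      · subst hb
        by_cases hi : i = 0
        · subst hi
          rw [br_comm, sub_self]
          simp only [Pi.inf_apply, if_true, brPow_succ]
          exact br_mono inf_le_right inf_le_left |>.trans' (by rw [br_comm])
        · simp [hi]
      · simp [hb]
  refine le_bot_iff.1 ((h2 K).trans fun i => ?_)
  simp only [hK, ite_self]
  exact le_rfl

end Kreknin

/-! ### Collecting letters: few components that act nilpotently. -/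

section Words

variable {R L M A : Type*} [CommRing R] [LieRing L] [LieAlgebra R L]
  [AddCommGroup M] [Module R M] [LieRingModule L M] [LieModule R L M] [AddCommGroup A]

theorem brPow_eq_bot_of_le {P : Submodule R L} {N : Submodule R M} {k k' : ℕ}
    (h : brPow P k N = ⊥) (hk : k ≤ k') : brPow P k' N = ⊥ := by
  rw [← Nat.sub_add_cancel hk, brPow_add, h, brPow_bot_right]

theorem brPow_le_of_stable {P : Submodule R L} {N : Submodule R M} (h : br P N ≤ N) (k : ℕ) :
    brPow P k N ≤ N := by
  induction k with
  | zero => exact le_rfl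
  | succ k ih => rw [brPow_succ]; exact (br_mono le_rfl ih).trans h

theorem br_brPow_le_of_normalizes {P Q : Submodule R L} {N : Submodule R M} (hQ : br P Q ≤ Q)
    (hN : br P N ≤ N) (k : ℕ) : br P (brPow Q k N) ≤ brPow Q k N := by
  induction k with
  | zero => exact hN
  | succ k ih =>
    rw [brPow_succ]
    exact (br_br_le _ _ _).trans (sup_le (br_mono le_rfl ih) (br_mono hQ le_rfl))

theorem word_le_of_stable {ι : Type*} {F : ι → Submodule R L} {N : Submodule R M}
    (h : ∀ a, br (F a) N ≤ N) (l : List ι) : word F l N ≤ N := by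
  induction l with
  | nil => exact le_rfl
  | cons a l ih => exact (br_mono le_rfl ih).trans (h a)

/-- If a graded Lie algebra with few nonzero components, each acting nilpotently on a module, is
soluble modulo the annihilator of this module, then it acts nilpotently. -/
theorem brPow_eq_bot_of_iterate_der {N : Submodule R M} {D : Finset A} {d K : ℕ}
    (hd : D.card ≤ d) (f : ℕ) :
    ∀ F : A → Submodule R L, Closed F → (∀ a, br (F a) N ≤ N) → (∀ a ∉ D, br (F a) N = ⊥) →
      (∀ a, brPow (F a) K N = ⊥) → (∀ a, br (der^[f] F a) N = ⊥) →
      brPow (⨆ a, F a) ((d * K + 1) ^ f) N = ⊥ := by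
  classical
  induction f with
  | zero =>
    intro F _ _ _ _ hf
    rw [pow_zero, ← zero_add 1, brPow_succ, brPow_zero, br_iSup_left, iSup_eq_bot]
    exact hf
  | succ f ih =>
    intro F hF hN hD hK hf
    have hle := hF.der_le
    have hX := ih (der F) hF.der (fun a => (br_mono (hle a) le_rfl).trans (hN a))
      (fun a ha => le_bot_iff.1 ((br_mono (hle a) le_rfl).trans (hD a ha).le))
      (fun a => le_bot_iff.1 ((brPow_mono (hle a) K le_rfl).trans (hK a).le)) hf
    set X := ⨆ a, der F a
    have hXF : ∀ a, br (F a) X ≤ X := fun a => by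
      rw [br_iSup_right]
      exact iSup_le fun b => (br_mono le_rfl (hle b)).trans
        ((br_le_der F a b).trans (le_iSup (der F) _))
    have hXN : br X N ≤ N := by
      rw [br_iSup_left]
      exact iSup_le fun a => (br_mono (hle a) le_rfl).trans (hN a)
    have hV : ∀ n a, br (F a) (brPow X n N) ≤ brPow X n N := fun n a =>
      br_brPow_le_of_normalizes (hXF a) (hN a) n
    -- Among d * K + 1 letters of `D` some letter occurs K times. Moving its occurrences to the
    -- inner end costs only brackets of two letters, which lie in the derived algebra `X` and so
    -- raise n; the collected word is zero.
    have hword : ∀ n l, l.length = d * K + 1 → word F l (brPow X n N) ≤ brPow X (n + 1) N := by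
      intro n l hl
      by_cases hlD : ∀ a ∈ l, a ∈ D
      · obtain ⟨a, -, l', hl'⟩ := exists_perm_append_replicate D K l hlD
          (by rw [hl]; exact Nat.lt_succ_of_le (Nat.mul_le_mul_right K hd))
        refine (word_perm_le (Z := fun _ _ => brPow X (n + 1) N) (fun a _ _ => hV _ a)
          (fun a b l => ?_) hl').trans (sup_le ?_ le_rfl)
        · rw [brPow_succ]
          exact br_mono ((br_le_der F a b).trans (le_iSup (der F) _))
            (word_le_of_stable (hV n) l)
        · have : brPow (F a) K (brPow X n N) = ⊥ :=
            le_bot_iff.1 ((brPow_mono le_rfl K (brPow_le_of_stable hXN n)).trans (hK a).le)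
          rw [word_append, word_replicate, this, word_bot]
          exact bot_le
      · push Not at hlD
        obtain ⟨a, hal, haD⟩ := hlD
        obtain ⟨l₁, l₂, rfl⟩ := List.append_of_mem hal
        have : br (F a) (word F l₂ (brPow X n N)) = ⊥ :=
          le_bot_iff.1 ((br_mono le_rfl ((word_le_of_stable (hV n) l₂).trans
            (brPow_le_of_stable hXN n))).trans (hD a haD).le)
        rw [word_append, word_cons, this, word_bot]
        exact bot_le
    have hpow : ∀ n, brPow (⨆ a, F a) ((d * K + 1) * n) N ≤ brPow X n N := by
      intro n
      induction n with
      | zero => rw [Nat.mul_zero, brPow_zero, brPow_zero]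
      | succ n ihn =>
        rw [Nat.mul_succ, add_comm, brPow_add]
        refine (brPow_mono le_rfl _ ihn).trans ?_
        rw [brPow_iSup_left]
        exact iSup_le fun l => hword n l.1 l.2
    rw [pow_succ']
    exact le_bot_iff.1 ((hpow _).trans hX.le)

/-- The sums of at most `n` elements of `D`. -/
def sumsLE [DecidableEq A] (D : Finset A) : ℕ → Finset A
  | 0 => {0}
  | n + 1 => Finset.image₂ (· + ·) (insert 0 D) (sumsLE D n)

theorem card_sumsLE_le [DecidableEq A] (D : Finset A) (n : ℕ) :
    (sumsLE D n).card ≤ (D.card + 1) ^ n := by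
  induction n with
  | zero => simp [sumsLE]
  | succ n ih =>
    rw [sumsLE, pow_succ']
    exact (Finset.card_image₂_le _ _ _).trans
      (Nat.mul_le_mul (Finset.card_insert_le _ _) ih)

theorem sum_mem_sumsLE [DecidableEq A] {D : Finset A} {n : ℕ} :
    ∀ {l : List A}, (∀ a ∈ l, a ∈ D) → l.length ≤ n → l.sum ∈ sumsLE D n := by
  induction n with
  | zero =>
    intro l _ hn
    simp [List.eq_nil_of_length_eq_zero (Nat.le_zero.1 hn), sumsLE]
  | succ n ih =>
    rintro (_ | ⟨a, l⟩) hl hn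
    · exact Finset.mem_image₂.2 ⟨0, Finset.mem_insert_self _ _, 0,
        by simpa using ih (l := []) (by simp) (by simp), by simp⟩
    · exact Finset.mem_image₂.2 ⟨a, Finset.mem_insert_of_mem (hl a (by simp)), l.sum,
        ih (fun b hb => hl b (by simp [hb])) (by simpa using hn), by simp⟩

/-- If only the components with degrees in `D` act nontrivially on `N`, then every word applied
to `N` reduces to short words with letters in `D`. -/
theorem word_le_short {F : A → Submodule R L} {N : Submodule R M} {D : Finset A} {K : ℕ}
    (hF : Closed F) (hK : ∀ a, brPow (F a) K (⊤ : Submodule R M) = ⊥)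
    (hD : ∀ a ∉ D, br (F a) N = ⊥) (n : ℕ) :
    ∀ l : List A, l.length = n → word F l N ≤
      ⨆ l' : {l' : List A // (∀ a ∈ l', a ∈ D) ∧ l'.length ≤ D.card * K ∧ l'.sum = l.sum},
        word F l'.1 N := by
  classical
  induction n using Nat.strong_induction_on with
  | _ n ih =>
  intro l hl
  -- A swap produces a word with one letter a + b in place of a and b: shorter, with the same sum,
  -- hence covered by the induction.
  have hperm : ∀ l', l.Perm l' → word F l' N = ⊥ → word F l N ≤
      ⨆ l' : {l' : List A // (∀ a ∈ l', a ∈ D) ∧ l'.length ≤ D.card * K ∧ l'.sum = l.sum},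
        word F l'.1 N := by
    intro l' hl' h0
    refine (word_perm_le (Z := fun n s => ⨆ l : {l : List A // l.length < n ∧ l.sum = s},
      word F l.1 N) (fun a n s => ?_) (fun a b l => ?_) hl').trans (sup_le ?_ ?_)
    · rw [br_iSup_right]
      exact iSup_le fun l => le_iSup_of_le
        ⟨a :: l.1, by simpa using l.2.1, by rw [List.sum_cons, l.2.2]⟩ le_rfl
    · exact le_iSup_of_le ⟨(a + b) :: l, by simp, by rw [List.sum_cons, add_assoc]⟩
        (br_mono (hF a b) le_rfl)
    · rw [h0]; exact bot_le
    · refine iSup_le ?_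
      rintro ⟨l'', hlen, hsum⟩
      have := ih _ (hl ▸ hlen) l'' rfl
      rwa [hsum] at this
  by_cases hlD : ∀ a ∈ l, a ∈ D
  · rcases le_or_gt l.length (D.card * K) with hlen | hlen
    · exact le_iSup_of_le ⟨l, hlD, hlen, rfl⟩ le_rfl
    · obtain ⟨a, -, l', hl'⟩ := exists_perm_append_replicate D K l hlD hlen
      refine hperm _ hl' ?_
      rw [word_append, word_replicate, le_bot_iff.1 ((brPow_mono le_rfl K le_top).trans (hK a).le),
        word_bot]
  · push Not at hlD
    obtain ⟨a, hal, haD⟩ := hlD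
    obtain ⟨l₁, l₂, rfl⟩ := List.append_of_mem hal
    refine hperm _ (List.perm_middle.trans (List.perm_append_singleton a (l₁ ++ l₂)).symm) ?_
    rw [word_append, word_cons, word_nil, hD a haD, word_bot]

/-- Nonzero words on N have their degree sum in the bounded set `S` of sums of short words. If `F a`
does not annihilate a word of sum s, then s and a + s both lie in `S`, so a lies in `S - S`. -/
theorem exists_finset_forall_br_word_eq_bot {F : A → Submodule R L} {N : Submodule R M}
    {D : Finset A} {K d : ℕ} (hF : Closed F) (hK : ∀ a, brPow (F a) K (⊤ : Submodule R M) = ⊥)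
    (hD : ∀ a ∉ D, br (F a) N = ⊥) (hd : D.card ≤ d) :
    ∃ E : Finset A, E.card ≤ ((d + 1) ^ (d * K)) ^ 2 ∧
      ∀ a ∉ E, ∀ l, br (F a) (word F l N) = ⊥ := by
  classical
  let S := sumsLE D (D.card * K)
  have hS : ∀ l, l.sum ∉ S → word F l N = ⊥ := fun l hl => by
    refine le_bot_iff.1 ((word_le_short hF hK hD _ l rfl).trans (iSup_le ?_))
    rintro ⟨l', h1, h2, h3⟩
    exact absurd (h3 ▸ sum_mem_sumsLE h1 h2) hl
  refine ⟨Finset.image₂ (· - ·) S S, (Finset.card_image₂_le _ _ _).trans ?_, fun a ha l => ?_⟩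
  · rw [sq]
    have := (card_sumsLE_le D (D.card * K)).trans ((Nat.pow_le_pow_left (Nat.succ_le_succ hd) _).trans
      (Nat.pow_le_pow_right (Nat.succ_pos d) (Nat.mul_le_mul_right K hd)))
    exact Nat.mul_le_mul this this
  · by_cases h1 : l.sum ∈ S
    · refine hS (a :: l) fun h2 => ha (Finset.mem_image₂.2 ⟨_, h2, _, h1, ?_⟩)
      simp
    · rw [hS l h1, br_bot_right]

end Words

/-! ### A functional that is nonzero on prescribed degrees. -/

/-- A plane over the field with `p` elements has a linear functional that does not vanish on
the nonzero elements of a given set with less than `p` elements. -/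
theorem exists_addMonoidHom_of_module {A : Type*} [AddCommGroup A] {p : ℕ} [Fact p.Prime]
    [Module (ZMod p) A] (hcard : Nat.card A = p ^ 2) (E : Finset A) (hE : E.card < p) :
    ∃ f : A →+ ZMod p, ∀ a ∈ E, f a = 0 → a = 0 := by
  classical
  have hp : p.Prime := Fact.out
  have : Finite A := Nat.finite_of_card_ne_zero (by rw [hcard]; exact pow_ne_zero 2 hp.ne_zero)
  have : Module.Finite (ZMod p) A := Module.Finite.of_finite
  have hrank : Module.finrank (ZMod p) A = 2 := by
    have h := Module.natCard_eq_pow_finrank (K := ZMod p) (V := A)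
    rw [hcard, Nat.card_zmod] at h
    exact (Nat.pow_right_injective hp.two_le h).symm
  let b : Module.Basis (Fin 2) (ZMod p) A := Module.finBasisOfFinrankEq _ _ hrank
  -- Each a rules out at most one t in the functional x₀ + t x₁. If a has x₁ = 0, division by zero
  -- merely excludes t = 0 as well, and the count is unaffected.
  let S : Finset (ZMod p) := E.image fun a => -(b.repr a 0) / b.repr a 1
  obtain ⟨t, ht⟩ : ∃ t, t ∉ S := by
    by_contra! hcon
    have h1 : S = Finset.univ := Finset.eq_univ_iff_forall.2 hcon
    have h2 : S.card ≤ E.card := Finset.card_image_le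
    rw [h1, Finset.card_univ, ZMod.card] at h2
    omega
  refine ⟨((b.coord 0 + t • b.coord 1 : A →ₗ[ZMod p] ZMod p)).toAddMonoidHom, fun a ha h => ?_⟩
  have h' : b.repr a 0 + t * b.repr a 1 = 0 := h
  have h1 : b.repr a 1 = 0 := by
    by_contra h1
    refine ht (Finset.mem_image.2 ⟨a, ha, ?_⟩)
    rw [div_eq_iff h1]
    linear_combination -h'
  have h0 : b.repr a 0 = 0 := by rwa [h1, mul_zero, add_zero] at h'
  refine b.ext_elem fun i => ?_
  fin_cases i
  · simpa using h0
  · simpa using h1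

theorem exists_addMonoidHom_forall_ne_zero {A : Type*} [AddCommGroup A] {p : ℕ} (hp : p.Prime)
    (hcard : Nat.card A = p ^ 2) (hA : ∀ a : A, p • a = 0) (E : Finset A) (hE : E.card < p) :
    ∃ f : A →+ ZMod p, ∀ a ∈ E, f a = 0 → a = 0 :=
  have : Fact p.Prime := ⟨hp⟩
  let _ : Module (ZMod p) A := AddCommGroup.zmodModule hA
  exists_addMonoidHom_of_module hcard E hE

/-! ### Ideals on which few components act. -/

section Ideal

variable {R L A : Type*} [CommRing R] [LieRing L] [LieAlgebra R L]

/-- The ideal of a graded Lie algebra generated by `G`. -/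
def wordIdeal {F : A → Submodule R L} (hF : ⨆ a, F a = ⊤) (G : Submodule R L) : LieIdeal R L where
  toSubmodule := ⨆ l, word F l G
  lie_mem {x m} hm := by
    have h : br (⊤ : Submodule R L) (⨆ l, word F l G) ≤ ⨆ l, word F l G := by
      rw [← hF, br_iSup_left]
      refine iSup_le fun a => ?_
      rw [br_iSup_right]
      exact iSup_le fun l => le_iSup (fun l => word F l G) (a :: l)
    exact h (lie_mem_br (Submodule.mem_top (x := x)) hm)

theorem toSubmodule_wordIdeal {F : A → Submodule R L} (hF : ⨆ a, F a = ⊤) (G : Submodule R L) :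
    (wordIdeal hF G).toSubmodule = ⨆ l, word F l G := rfl

theorem br_lieIdeal_le (I : LieIdeal R L) (P : Submodule R L) :
    br P I.toSubmodule ≤ I.toSubmodule :=
  br_le.2 fun x _ _ hn => I.lie_mem (x := x) hn

attribute [local instance 100] LieRing.ofAssociativeRing

theorem map_toEnd_eq_bot_iff (I : LieIdeal R L) (P : Submodule R L) :
    P.map (LieModule.toEnd R L I : L →ₗ[R] Module.End R I) = ⊥ ↔ br P I.toSubmodule = ⊥ := by
  rw [← le_bot_iff, ← le_bot_iff, Submodule.map_le_iff_le_comap, br_le]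
  refine forall₂_congr fun x _ => ⟨fun h n hn => ?_, fun h => ?_⟩
  · have h' : LieModule.toEnd R L I x = 0 := h
    have := congrArg Subtype.val (LinearMap.congr_fun h' (⟨n, hn⟩ : I))
    simpa using this
  · change LieModule.toEnd R L I x = 0
    refine LinearMap.ext fun n => Subtype.ext ?_
    simpa using h n.1 n.2

variable [AddCommGroup A]

/-- An ideal on which few components of the Lie algebra act nontrivially is annihilated by a
derived subalgebra of bounded index. -/
theorem br_iterate_der_lieIdeal_eq_bot {F : A → Submodule R L} {K n p : ℕ} (hF : Closed F)
    (hK : ∀ a, brPow (F a) K (⊤ : Submodule R L) = ⊥) (I : LieIdeal R L) {E : Finset A}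
    (hE : ∀ a ∉ E, br (F a) I.toSubmodule = ⊥) (hn : E.card ≤ n) (hp : p.Prime) (hnp : n < p)
    (hcard : Nat.card A = p ^ 2) (hA : ∀ a : A, p • a = 0) (a : A) :
    br (der^[K + krekninBound K n] F a) I.toSubmodule = ⊥ := by
  classical
  have : NeZero p := ⟨hp.ne_zero⟩
  obtain ⟨f, hf⟩ := exists_addMonoidHom_forall_ne_zero hp hcard hA E (hn.trans_lt hnp)
  let φ : L →ₗ⁅R⁆ Module.End R I := LieModule.toEnd R L I
  let F' : A → Submodule R (Module.End R I) := fun a => (F a).map (φ : L →ₗ[R] Module.End R I)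
  have hF' : Closed F' := hF.map φ
  have hF'E : ∀ a ∉ E, F' a = ⊥ := fun a ha => (map_toEnd_eq_bot_iff I _).2 (hE a ha)
  let Q : ZMod p → Submodule R (Module.End R I) := fun i => ⨆ a : {a : A // f a = i}, F' a
  have hQ : Closed Q := fun i j => by
    simp only [Q, br_iSup_left, br_iSup_right]
    refine iSup₂_le fun a b => (hF' _ _).trans ?_
    exact le_iSup (fun a : {a : A // f a = i + j} => F' a)
      ⟨b.1 + a.1, by rw [map_add, a.2, b.2]⟩
  -- Among the degrees in the kernel of f, only 0 can act nontrivially, so the coarser grading keeps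
  -- a nilpotent zero component.
  have hQ0 : Q 0 ≤ F' 0 := iSup_le fun ⟨a, ha⟩ => by
    by_cases haE : a ∈ E
    · obtain rfl := hf a haE ha
      exact le_rfl
    · rw [hF'E a haE]; exact bot_le
  have hK0 : ∀ i, brPow (Q 0) K (Q i) = ⊥ := fun i => by
    rw [brPow_iSup_right, iSup_eq_bot]
    refine fun a => le_bot_iff.1 ((brPow_mono hQ0 K le_rfl).trans ?_)
    rw [← map_brPow, le_bot_iff.1 ((brPow_mono le_rfl K le_top).trans (hK 0).le),
      Submodule.map_bot]
  have hcardQ : {i : ZMod p | Q i ≠ ⊥}.ncard ≤ n := by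
    have hsub : {i : ZMod p | Q i ≠ ⊥} ⊆ ↑(E.image f) := fun i hi => by
      by_contra hcon
      refine hi (iSup_eq_bot.2 fun a => hF'E _ fun haE => hcon ?_)
      rw [Finset.coe_image]
      exact ⟨a.1, haE, a.2⟩
    refine (Set.ncard_le_ncard hsub (Finset.finite_toSet _)).trans ?_
    rw [Set.ncard_coe_finset]
    exact Finset.card_image_le.trans hn
  have hder : ∀ m a, der^[m] F' a ≤ der^[m] Q (f a) := by
    intro m
    induction m with
    | zero => exact fun a => le_iSup (fun b : {b : A // f b = f a} => F' b) ⟨a, rfl⟩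
    | succ m ih =>
      intro a
      simp only [Function.iterate_succ_apply']
      refine iSup_le fun b => (br_mono (ih b) (ih (a - b))).trans ?_
      rw [map_sub]
      exact le_iSup (fun i => br (der^[m] Q i) (der^[m] Q (f a - i))) (f b)
  rw [← map_toEnd_eq_bot_iff]
  refine (map_iterate_der φ F _ a).trans (le_bot_iff.1 ((hder _ a).trans ?_))
  rw [iterate_der_eq_bot hQ hK0 hcardQ]
  exact le_rfl

/-- The bound for the number of homogeneous components that act nontrivially on an ideal whose
generators are centralized by all but `d` components. -/
def supportBound (K d : ℕ) : ℕ := ((d + 1) ^ (d * K)) ^ 2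

/-- The bound for the length of words acting nontrivially on such an ideal. -/
def actionBound (K d : ℕ) : ℕ :=
  (supportBound K d * K + 1) ^ (K + krekninBound K (supportBound K d))

theorem brPow_wordIdeal_eq_bot {F : A → Submodule R L} {K d p : ℕ} (hF : Closed F)
    (hsup : ⨆ a, F a = ⊤) (hK : ∀ a, brPow (F a) K (⊤ : Submodule R L) = ⊥) {G : Submodule R L}
    {D : Finset A} (hD : ∀ a ∉ D, br (F a) G = ⊥) (hd : D.card ≤ d) (hp : p.Prime)
    (hdp : supportBound K d < p) (hcard : Nat.card A = p ^ 2) (hA : ∀ a : A, p • a = 0) :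
    brPow (⊤ : Submodule R L) (actionBound K d) (wordIdeal hsup G).toSubmodule = ⊥ := by
  obtain ⟨E, hEc, hE⟩ := exists_finset_forall_br_word_eq_bot hF hK hD hd
  have hE' : ∀ a ∉ E, br (F a) (wordIdeal hsup G).toSubmodule = ⊥ := fun a ha => by
    rw [toSubmodule_wordIdeal, br_iSup_right, iSup_eq_bot]
    exact hE a ha
  rw [← hsup]
  exact brPow_eq_bot_of_iterate_der hEc _ F hF (fun a => br_lieIdeal_le _ _) hE'
    (fun a => le_bot_iff.1 ((brPow_mono le_rfl K le_top).trans (hK a).le))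
    (br_iterate_der_lieIdeal_eq_bot hF hK _ hE' hEc hp hdp hcard hA)

/-- The projection onto the quotient by an ideal, as a homomorphism of Lie algebras. -/
def lieMk (I : LieIdeal R L) : L →ₗ⁅R⁆ L ⧸ I :=
  { (LieSubmodule.Quotient.mk' I : L →ₗ[R] L ⧸ I) with
    map_lie' := fun {x y} => LieSubmodule.Quotient.mk_bracket I x y }

theorem map_lieMk_eq_bot_iff (I : LieIdeal R L) (P : Submodule R L) :
    P.map (lieMk I : L →ₗ[R] L ⧸ I) = ⊥ ↔ P ≤ I.toSubmodule := by
  rw [← le_bot_iff, Submodule.map_le_iff_le_comap]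
  exact forall₂_congr fun x _ => LieSubmodule.Quotient.mk_eq_zero' (N := I)

theorem map_lieMk_top (I : LieIdeal R L) :
    (⊤ : Submodule R L).map (lieMk I : L →ₗ[R] L ⧸ I) = ⊤ :=
  LinearMap.range_eq_top.2 (LieSubmodule.Quotient.surjective_mk' I) ▸ Submodule.map_top _

end Ideal

/-! ### Independent sequences of degrees. -/

section Independence

variable {H A : Type*} [AddCommGroup A]

/-- The sum of the displacements `a - a ^ h` over the pairs `(h, a)` in `u`. -/
def disp (σ : H → A →+ A) (u : Multiset (H × A)) : A :=
  (u.map fun x => x.2 - σ x.1 x.2).sum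

/-- A family `s` of elements of `A` is independent if replacing its members by elements of their
orbits changes its sum, unless all replacements are trivial. -/
def Indep [One H] (σ : H → A →+ A) (s : Multiset A) : Prop :=
  ∀ u : Multiset (H × A), u.map Prod.snd = s → disp σ u = 0 → ∀ x ∈ u, x.1 = 1

theorem exists_finset_disp_mem [Fintype H] (σ : H → A →+ A) (s : Multiset A) :
    ∃ S : Finset A, S.card ≤ Fintype.card H ^ s.card ∧
      ∀ u : Multiset (H × A), u.map Prod.snd = s → disp σ u ∈ S := by
  classical
  induction s using Multiset.induction_on with
  | empty =>
    refine ⟨{0}, by simp, fun u hu => ?_⟩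
    rw [Multiset.map_eq_zero] at hu
    simp [hu, disp]
  | cons a s ih =>
    obtain ⟨S, hS, hu⟩ := ih
    refine ⟨Finset.image₂ (fun h x => a - σ h a + x) Finset.univ S, ?_, fun u h => ?_⟩
    · rw [Multiset.card_cons, pow_succ']
      exact (Finset.card_image₂_le _ _ _).trans (Nat.mul_le_mul_left _ hS)
    · obtain ⟨x, hx, rfl, hs⟩ := (Multiset.map_eq_cons _ _ _ _).2 h
      refine Finset.mem_image₂.2 ⟨x.1, Finset.mem_univ _, _, hu _ hs, ?_⟩
      conv_rhs => rw [← Multiset.cons_erase hx]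
      simp [disp]

/-- If adding a destroys independence, then a - a^h = -x for some h ≠ 1 and some displacement x of
s. As h fixes only 0, the map a ↦ a - a^h is injective, so each pair (h, x) excludes one a. The
pairs with h = 1 contribute irrelevant values of `invFun`. -/
theorem exists_finset_indep_cons [One H] [Fintype H] {σ : H → A →+ A}
    (h1 : σ 1 = AddMonoidHom.id A) (hσ : ∀ h, h ≠ 1 → ∀ a, σ h a = a → a = 0)
    {s : Multiset A} (hs : Indep σ s) :
    ∃ D : Finset A, D.card ≤ Fintype.card H ^ (s.card + 1) ∧ ∀ a ∉ D, Indep σ (a ::ₘ s) := by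
  classical
  obtain ⟨S, hS, hu⟩ := exists_finset_disp_mem σ s
  refine ⟨Finset.image₂ (fun h x => Function.invFun (fun a => a - σ h a) (-x)) Finset.univ S,
    ?_, fun a ha u h h0 => ?_⟩
  · rw [pow_succ']
    exact (Finset.card_image₂_le _ _ _).trans (Nat.mul_le_mul_left _ hS)
  · obtain ⟨x, hx, rfl, hs'⟩ := (Multiset.map_eq_cons _ _ _ _).2 h
    have hcons := Multiset.cons_erase hx
    have h0' : x.2 - σ x.1 x.2 + disp σ (u.erase x) = 0 := by
      rw [← h0]
      conv_rhs => rw [← hcons]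
      simp [disp]
    have hx1 : x.1 = 1 := by
      by_contra hx1
      refine ha (Finset.mem_image₂.2 ⟨x.1, Finset.mem_univ _, _, hu _ hs', ?_⟩)
      have hinj : Function.Injective fun a => a - σ x.1 a := fun a b hab => by
        refine sub_eq_zero.1 (hσ _ hx1 _ ?_)
        have hab' : a - σ x.1 a = b - σ x.1 b := hab
        rw [map_sub, ← sub_eq_zero]
        rw [← sub_eq_zero] at hab'
        rw [← neg_eq_zero, ← hab']
        abel
      rw [← eq_neg_of_add_eq_zero_left h0']
      exact Function.leftInverse_invFun hinj x.2
    intro y hy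
    rw [← hcons, Multiset.mem_cons] at hy
    rcases hy with rfl | hy
    · exact hx1
    · exact hs _ hs' (by simpa [hx1, h1] using h0') y hy

end Independence

/-! ### Selective nilpotency implies nilpotency. -/

section Selective

variable {R A H : Type*} [CommRing R] [AddCommGroup A] [One H]

/-- The selective nilpotency condition: words with independent degrees vanish. -/
def Selective {L : Type*} [LieRing L] [LieAlgebra R L] (σ : H → A →+ A) (F : A → Submodule R L)
    (m : ℕ) : Prop :=
  ∀ (a : A) (l : List A), l.length = m → Indep σ (a ::ₘ (l : Multiset A)) → word F l (F a) = ⊥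

/-- A bound for the nilpotency class of a selectively `m`-nilpotent algebra. -/
def classBound (q K : ℕ) : ℕ → ℕ
  | 0 => K
  | m + 1 => actionBound K (q ^ (m + 2)) + classBound q K m

/-- A bound for the characteristic needed in the induction on `m`. -/
def primeBound (q K : ℕ) : ℕ → ℕ
  | 0 => 0
  | m + 1 => max (primeBound q K m) (supportBound K (q ^ (m + 2)) + 1)

/-- Induction on m, passing to the quotient by the ideals generated by the independent words of
length m. For m = 0 every nonzero degree is independent by itself, so L equals its zero component.
-/
theorem brPow_eq_bot_of_selective [Fintype H] {σ : H → A →+ A} (h1 : σ 1 = AddMonoidHom.id A)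
    (hσ : ∀ h, h ≠ 1 → ∀ a, σ h a = a → a = 0) {K p : ℕ} (hp : p.Prime)
    (hcard : Nat.card A = p ^ 2) (hA : ∀ a : A, p • a = 0) (m : ℕ)
    (hpm : primeBound (Fintype.card H) K m ≤ p) :
    ∀ {L : Type*} [LieRing L] [LieAlgebra R L] (F : A → Submodule R L), Closed F →
      ⨆ a, F a = ⊤ → (∀ a, brPow (F a) K (⊤ : Submodule R L) = ⊥) → Selective σ F m →
      brPow (⊤ : Submodule R L) (classBound (Fintype.card H) K m) (⊤ : Submodule R L) = ⊥ := by
  induction m with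
  | zero =>
    intro L _ _ F _ hsup hK hsel
    have h0 : ∀ a, a ≠ 0 → F a = ⊥ := fun a ha => by
      refine hsel a [] rfl fun u hu h0 x hx => ?_
      obtain ⟨y, rfl, hy⟩ := Multiset.map_eq_singleton.1 hu
      obtain rfl := Multiset.mem_singleton.1 hx
      by_contra hx1
      have h0' : x.2 - σ x.1 x.2 = 0 := by simpa [disp] using h0
      exact ha (hy ▸ hσ _ hx1 _ (sub_eq_zero.1 h0').symm)
    have htop : (⊤ : Submodule R L) = F 0 := by
      refine le_antisymm (hsup ▸ iSup_le fun a => ?_) le_top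
      by_cases ha : a = 0
      · rw [ha]
      · rw [h0 a ha]; exact bot_le
    have := hK 0
    rwa [← htop] at this
  | succ m ih =>
    intro L _ _ F hF hsup hK hsel
    let T := {x : A × List A // x.2.length = m ∧ Indep σ (x.1 ::ₘ (x.2 : Multiset A))}
    let G : T → LieIdeal R L := fun x => wordIdeal hsup (word F x.1.2 (F x.1.1))
    have hG : ∀ x, brPow (⊤ : Submodule R L) (actionBound K (Fintype.card H ^ (m + 2)))
        (G x).toSubmodule = ⊥ := by
      rintro ⟨⟨a, l⟩, hl, hind⟩
      -- The word has m letters and one initial entry, whence the exponent m + 2 in the bound for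
      -- `D`.
      obtain ⟨D, hDc, hD⟩ := exists_finset_indep_cons h1 hσ hind
      simp only [Multiset.card_cons, Multiset.coe_card, hl] at hDc
      refine brPow_wordIdeal_eq_bot hF hsup hK (D := D) (fun b hb => ?_) hDc hp
        (lt_of_lt_of_le (Nat.lt_succ_self _) ((le_max_right _ _).trans hpm)) hcard hA
      refine hsel a (b :: l) (by simp [hl]) ?_
      have := hD b hb
      rwa [Multiset.cons_swap, Multiset.cons_coe b l] at this
    let I : LieIdeal R L := ⨆ x, G x
    have hI : brPow (⊤ : Submodule R L) (actionBound K (Fintype.card H ^ (m + 2)))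
        I.toSubmodule = ⊥ := by
      rw [LieSubmodule.iSup_toSubmodule, brPow_iSup_right, iSup_eq_bot]
      exact hG
    have hquot := ih ((le_max_left _ _).trans hpm) (L := L ⧸ I)
      (fun a => (F a).map (lieMk I : L →ₗ[R] L ⧸ I)) (hF.map (lieMk I))
      (by rw [← Submodule.map_iSup, hsup, map_lieMk_top])
      (fun a => by rw [← map_lieMk_top, ← map_brPow, hK, Submodule.map_bot])
      (fun a l hl hind => by
        rw [← map_word, map_lieMk_eq_bot_iff, LieSubmodule.iSup_toSubmodule]
        refine le_iSup_of_le ⟨(a, l), hl, hind⟩ ?_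
        exact le_iSup (fun l' => word F l' (word F l (F a))) [])
    rw [← map_lieMk_top, ← map_brPow, map_lieMk_eq_bot_iff] at hquot
    rw [classBound, brPow_add]
    exact le_bot_iff.1 ((brPow_mono le_rfl _ hquot).trans hI.le)

theorem brPow_le_shift {L : Type*} [LieRing L] [LieAlgebra R L] {F : A → Submodule R L}
    (hF : Closed F) (a b : A) (j : ℕ) : brPow (F b) j (F a) ≤ F (a + j • b) := by
  induction j with
  | zero => simp
  | succ j ih =>
    rw [brPow_succ, succ_nsmul', ← add_assoc, add_comm a b, add_assoc]
    exact (br_mono le_rfl ih).trans (hF _ _)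

/-- In a selectively nilpotent algebra the components act nilpotently, provided that repetitions
of their degrees are independent. -/
theorem brPow_eq_bot_of_indep_replicate [Fintype H] {L : Type*} [LieRing L] [LieAlgebra R L]
    {σ : H → A →+ A} (h1 : σ 1 = AddMonoidHom.id A) (hσ : ∀ h, h ≠ 1 → ∀ a, σ h a = a → a = 0)
    {c p : ℕ} (hp : p.Prime) (hA : ∀ a : A, p • a = 0) {F : A → Submodule R L} (hF : Closed F)
    (hsup : ⨆ a, F a = ⊤) (hsel : Selective σ F c) (hcp : Fintype.card H ^ (c + 1) < p) {b : A}
    (hb : b ≠ 0) (hind : Indep σ (Multiset.replicate c b)) :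
    brPow (F b) (c + Fintype.card H ^ (c + 1)) (⊤ : Submodule R L) = ⊥ := by
  classical
  obtain ⟨D, hDc, hD⟩ := exists_finset_indep_cons h1 hσ hind
  rw [Multiset.card_replicate] at hDc
  rw [← hsup, brPow_iSup_right, iSup_eq_bot]
  intro a
  -- The degrees a + j b are distinct for j < p, so one of the first q ^ (c + 1) + 1 of them avoids
  -- `D`. After j brackets with `F b`, the next c brackets form an independent word.
  obtain ⟨j, hj, hjD⟩ : ∃ j < Fintype.card H ^ (c + 1) + 1, a + j • b ∉ D := by
    by_contra! hcon
    have hinj : Set.InjOn (fun j : ℕ => a + j • b)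
        (Finset.range (Fintype.card H ^ (c + 1) + 1) : Set ℕ) := by
      have : Fact p.Prime := ⟨hp⟩
      have hord : addOrderOf b = p := addOrderOf_eq_prime (hA b) hb
      intro i hi j hj hij
      rw [Finset.coe_range, Set.mem_Iio] at hi hj
      refine nsmul_injOn_Iio_addOrderOf ?_ ?_ (add_left_cancel hij) <;>
        rw [Set.mem_Iio, hord] <;> omega
    have := Finset.card_le_card_of_injOn (t := D) _ (fun j hj => hcon j (by simpa using hj)) hinj
    rw [Finset.card_range] at this
    omega
  refine brPow_eq_bot_of_le (k := c + j) ?_ (by omega)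
  rw [brPow_add]
  refine le_bot_iff.1 ((brPow_mono le_rfl c (brPow_le_shift hF a b j)).trans ?_)
  rw [← word_replicate]
  exact (hsel _ _ (by simp) (by rw [Multiset.coe_replicate]; exact hD _ hjD)).le

end Selective

/-! ### Independence of repetitions: a linear system over ℤ read modulo p. -/

section Convolution

variable {H : Type*} [Group H] [Fintype H]

/-- The integer matrix of the system `∑_{h ∈ s} (v g - v (g h)) = 0`, `∑_j v (g k ^ j) = 0`. -/
def orbitMatrix [DecidableEq H] (s : Multiset H) (k : H) : Matrix (H ⊕ H) H ℤ
  | Sum.inl g, x => (s.map fun h => (if x = g then 1 else 0) - if x = g * h then 1 else 0).sum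
  | Sum.inr g, x => ∑ j ∈ Finset.range (Fintype.card H), if x = g * k ^ j then 1 else 0

theorem sum_orbitMatrix_inl [DecidableEq H] {W : Type*} [AddCommGroup W] (s : Multiset H) (k : H)
    (v : H → W) (g : H) :
    ∑ x, orbitMatrix s k (Sum.inl g) x • v x = (s.map fun h => v g - v (g * h)).sum := by
  simp only [orbitMatrix]
  induction s using Multiset.induction_on with
  | empty => simp
  | cons h s ih =>
    simp only [Multiset.map_cons, Multiset.sum_cons, add_smul, Finset.sum_add_distrib, ih]
    simp [sub_smul, Finset.sum_sub_distrib, ite_smul]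

theorem sum_orbitMatrix_inr [DecidableEq H] {W : Type*} [AddCommGroup W] (s : Multiset H) (k : H)
    (v : H → W) (g : H) :
    ∑ x, orbitMatrix s k (Sum.inr g) x • v x =
      ∑ j ∈ Finset.range (Fintype.card H), v (g * k ^ j) := by
  simp only [orbitMatrix, Finset.sum_smul]
  rw [Finset.sum_comm]
  simp [ite_smul]

theorem abs_orbitMatrix_le [DecidableEq H] (s : Multiset H) (k : H) (i : H ⊕ H) (x : H) :
    |orbitMatrix s k i x| ≤ s.card + Fintype.card H := by
  rcases i with g | g
  · have : |orbitMatrix s k (Sum.inl g) x| ≤ s.card := by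
      simp only [orbitMatrix]
      induction s using Multiset.induction_on with
      | empty => simp
      | cons h s ih =>
        simp only [Multiset.map_cons, Multiset.sum_cons, Multiset.card_cons]
        refine (abs_add_le _ _).trans ?_
        have : |((if x = g then 1 else 0) - if x = g * h then 1 else 0 : ℤ)| ≤ 1 := by
          split_ifs <;> simp
        push_cast
        linarith
    have h2 : (0 : ℤ) ≤ Fintype.card H := Nat.cast_nonneg _
    linarith
  · have : |orbitMatrix s k (Sum.inr g) x| ≤ Fintype.card H := by
      simp only [orbitMatrix]
      refine (Finset.abs_sum_le_sum_abs _ _).trans ?_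
      refine (Finset.sum_le_card_nsmul _ _ 1 fun j _ => ?_).trans_eq (by simp)
      split_ifs <;> simp
    have h2 : (0 : ℤ) ≤ s.card := Nat.cast_nonneg _
    linarith

/-- The maximum principle for functions on a finite group. -/
theorem le_zero_of_harmonic {s : Multiset H} {k : H} (hk : k ∈ s) {w : H → ℤ}
    (h1 : ∀ g, (s.map fun h => w g - w (g * h)).sum = 0)
    (h2 : ∀ g, ∑ j ∈ Finset.range (Fintype.card H), w (g * k ^ j) = 0) (x : H) : w x ≤ 0 := by
  obtain ⟨g, hg⟩ := Finite.exists_max w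
  -- At a maximum all terms w y - w (y h) are nonnegative with zero sum, so the maximum is also
  -- attained at y k. It spreads along the powers of k, over which w sums to zero.
  have hstep : ∀ y, w y = w g → w (y * k) = w g := fun y hy => by
    have hnn : ∀ z ∈ s.map fun h => w y - w (y * h), 0 ≤ z := fun z hz => by
      obtain ⟨h, -, rfl⟩ := Multiset.mem_map.1 hz
      rw [hy]
      exact sub_nonneg.2 (hg _)
    have h0 := (Multiset.sum_nonneg hnn).lt_or_eq.resolve_left (by rw [h1 y]; exact lt_irrefl _)
    have := Multiset.single_le_sum hnn _ (Multiset.mem_map_of_mem _ hk)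
    rw [h1 y, hy] at this
    exact le_antisymm (hg _) (by linarith)
  have hpow : ∀ j : ℕ, w (g * k ^ j) = w g := fun j => by
    induction j with
    | zero => simp
    | succ j ih => rw [pow_succ, ← mul_assoc]; exact hstep _ ih
  have := h2 g
  simp only [hpow, Finset.sum_const, Finset.card_range, nsmul_eq_mul, mul_eq_zero] at this
  rcases this with h | h
  · exact absurd h (by exact_mod_cast Fintype.card_ne_zero)
  · exact (hg x).trans h.le

/-- The maximum principle applied to w and -w leaves only the zero integer solution. The system has
twice as many equations as unknowns, hence the Gram matrix. -/
theorem det_orbitMatrix_ne_zero [DecidableEq H] {s : Multiset H} {k : H} (hk : k ∈ s) :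
    ((orbitMatrix s k).transpose * orbitMatrix s k).det ≠ 0 := by
  intro hdet
  obtain ⟨w, hw, h0⟩ := Matrix.exists_mulVec_eq_zero_iff.2 hdet
  have h1 : (orbitMatrix s k).mulVec w = 0 := by
    rw [← dotProduct_self_eq_zero]
    rw [← Matrix.mulVec_mulVec] at h0
    rw [Matrix.dotProduct_mulVec, ← Matrix.mulVec_transpose, h0, zero_dotProduct]
  have hl : ∀ g, (s.map fun h => w g - w (g * h)).sum = 0 := fun g => by
    rw [← sum_orbitMatrix_inl s k]
    exact congrFun h1 (Sum.inl g)
  have hr : ∀ g, ∑ j ∈ Finset.range (Fintype.card H), w (g * k ^ j) = 0 := fun g => by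
    rw [← sum_orbitMatrix_inr s k]
    exact congrFun h1 (Sum.inr g)
  refine hw (funext fun x => le_antisymm (le_zero_of_harmonic hk hl hr x) ?_)
  have := le_zero_of_harmonic hk (w := -w) (fun g => ?_) (fun g => ?_) x
  · simpa using this
  · have := congrArg Neg.neg (hl g)
    rw [neg_zero, ← Multiset.sum_map_neg] at this
    rw [← this]
    congr 1
    refine Multiset.map_congr rfl fun h _ => ?_
    simp
    ring
  · simp [hr g]

/-- A bound for the determinant of the system. -/
def detBound (c q : ℕ) : ℕ := q.factorial * (2 * q * (c + q) ^ 2) ^ q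

theorem abs_det_orbitMatrix_le [DecidableEq H] (s : Multiset H) (k : H) :
    |((orbitMatrix s k).transpose * orbitMatrix s k).det| ≤ detBound s.card (Fintype.card H) := by
  have hentry : ∀ i j, |((orbitMatrix s k).transpose * orbitMatrix s k) i j| ≤
      2 * Fintype.card H * (s.card + Fintype.card H) ^ 2 := fun i j => by
    rw [Matrix.mul_apply]
    refine (Finset.abs_sum_le_sum_abs _ _).trans
      ((Finset.sum_le_card_nsmul _ _ ((s.card + Fintype.card H : ℤ) ^ 2) fun x _ => ?_).trans_eq ?_)
    · rw [Matrix.transpose_apply, abs_mul, sq]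
      exact mul_le_mul (abs_orbitMatrix_le s k x i) (abs_orbitMatrix_le s k x j) (abs_nonneg _)
        (by positivity)
    · rw [Finset.card_univ, Fintype.card_sum, nsmul_eq_mul]
      push_cast
      ring
  refine (Matrix.det_le (abv := AbsoluteValue.abs) hentry).trans_eq ?_
  simp [detBound]

/-- The adjugate of the Gram matrix shows that its determinant annihilates every v x. That
determinant is nonzero and smaller than p in absolute value, while p annihilates A. -/
theorem eq_zero_of_orbitMatrix {A : Type*} [AddCommGroup A] {p : ℕ} (hp : p.Prime)
    (hA : ∀ a : A, p • a = 0) {s : Multiset H} {k : H} (hk : k ∈ s)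
    (hlt : detBound s.card (Fintype.card H) < p) {v : H → A}
    (h1 : ∀ g, (s.map fun h => v g - v (g * h)).sum = 0)
    (h2 : ∀ g, ∑ j ∈ Finset.range (Fintype.card H), v (g * k ^ j) = 0) (x : H) : v x = 0 := by
  classical
  set M := orbitMatrix s k with hM
  set N := M.transpose * M with hN
  have hMv : ∀ i, ∑ y, M i y • v y = 0 := by
    rintro (g | g)
    · rw [sum_orbitMatrix_inl, h1]
    · rw [sum_orbitMatrix_inr, h2]
  have key : ∀ {m n : Type _} [Fintype m] [Fintype n] (P : Matrix n m ℤ) (Q : Matrix m H ℤ),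
      (∀ i, ∑ y, Q i y • v y = 0) → ∀ i, ∑ y, (P * Q) i y • v y = 0 := by
    intro m n _ _ P Q hQ i
    simp only [Matrix.mul_apply, Finset.sum_smul]
    rw [Finset.sum_comm]
    simp only [mul_smul, ← Finset.smul_sum, hQ, smul_zero, Finset.sum_const_zero]
  have hdet : N.det • v x = 0 := by
    have := key N.adjugate N (key M.transpose M hMv) x
    rw [Matrix.adjugate_mul] at this
    simpa [Matrix.one_apply, ite_smul, mul_smul] using this
  have hd1 : addOrderOf (v x) ∣ p := addOrderOf_dvd_of_nsmul_eq_zero (hA _)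
  have hd2 : (addOrderOf (v x) : ℤ) ∣ N.det := addOrderOf_dvd_iff_zsmul_eq_zero.2 hdet
  rcases (Nat.dvd_prime hp).1 hd1 with h | h
  · exact AddMonoid.addOrderOf_eq_one_iff.1 h
  · rw [h] at hd2
    have h3 := Int.le_of_dvd (abs_pos.2 (det_orbitMatrix_ne_zero hk)) ((dvd_abs _ _).2 hd2)
    have h4 := abs_det_orbitMatrix_le s k
    have h5 : (detBound s.card (Fintype.card H) : ℤ) < p := by exact_mod_cast hlt
    exact absurd (h3.trans h4) (not_le.2 h5)

/-- Repetitions of a nonzero element of a group of large prime exponent are independent with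
respect to a fixed-point-free finite group of automorphisms. -/
theorem indep_replicate {A : Type*} [AddCommGroup A] {p : ℕ} (hp : p.Prime)
    (hA : ∀ a : A, p • a = 0) {σ : H → A →+ A} (h1 : σ 1 = AddMonoidHom.id A)
    (hσ : ∀ h, h ≠ 1 → ∀ a, σ h a = a → a = 0) {c : ℕ}
    (hlt : detBound c (Fintype.card H) < p) {b : A} (hb : b ≠ 0)
    (hmul : ∀ g h, σ g (σ h b) = σ (g * h) b) : Indep σ (Multiset.replicate c b) := by
  intro u hu h0
  by_contra! hcon
  obtain ⟨⟨k, b'⟩, hku, hk1⟩ := hcon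
  have hub : ∀ x ∈ u, x.2 = b := fun x hx =>
    Multiset.eq_of_mem_replicate (hu ▸ Multiset.mem_map_of_mem Prod.snd hx)
  set s := u.map Prod.fst with hs
  have hsc : s.card = c := by
    rw [hs, Multiset.card_map, ← Multiset.card_map Prod.snd, hu, Multiset.card_replicate]
  have hks : k ∈ s := Multiset.mem_map_of_mem Prod.fst hku
  have hdisp : (s.map fun h => b - σ h b).sum = 0 := by
    rw [← h0, hs, Multiset.map_map, disp]
    congr 1
    exact Multiset.map_congr rfl fun x hx => by simp [hub x hx]
  refine hb ?_
  have := eq_zero_of_orbitMatrix hp hA hks (by rwa [hsc]) (v := fun g => σ g b) (fun g => ?_)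
    (fun g => ?_) 1
  · simpa [h1] using this
  · have := congrArg (σ g) hdisp
    rw [map_zero, map_multiset_sum, Multiset.map_map] at this
    rw [← this]
    congr 1
    exact Multiset.map_congr rfl fun x hx => by simp [hmul]
  · have hsum : ∑ j ∈ Finset.range (Fintype.card H), σ (k ^ j) b = 0 := by
      refine hσ k hk1 _ ?_
      rw [map_sum]
      simp only [hmul, ← pow_succ']
      have e1 := Finset.sum_range_succ (fun j => σ (k ^ j) b) (Fintype.card H)
      have e2 := Finset.sum_range_succ' (fun j => σ (k ^ j) b) (Fintype.card H)
      rw [e1, pow_card_eq_one, pow_zero] at e2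
      exact (add_right_cancel e2).symm
    have := congrArg (σ g) hsum
    rw [map_zero, map_sum] at this
    simpa only [hmul] using this

end Convolution

/-! ### The lower central series as iterated brackets. -/

section LowerCentralSeries

variable {R L : Type*} [CommRing R] [LieRing L] [LieAlgebra R L]

theorem toSubmodule_lowerCentralSeries (k : ℕ) :
    (LieModule.lowerCentralSeries R L L k).toSubmodule =
      brPow (⊤ : Submodule R L) k (⊤ : Submodule R L) := by
  induction k with
  | zero => rfl
  | succ k ih =>
    rw [LieModule.lowerCentralSeries_succ, LieSubmodule.lieIdeal_oper_eq_linear_span', brPow_succ,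
      ← ih]
    refine le_antisymm (Submodule.span_le.2 ?_) (br_le.2 fun x _ n hn => ?_)
    · rintro _ ⟨x, -, n, hn, rfl⟩
      exact lie_mem_br Submodule.mem_top hn
    · exact Submodule.subset_span ⟨x, trivial, n, hn, rfl⟩

theorem nilpotentClassLE_iff (c : ℕ) :
    NilpotentClassLE R L c ↔ brPow (⊤ : Submodule R L) c (⊤ : Submodule R L) = ⊥ := by
  rw [NilpotentClassLE, ← LieSubmodule.toSubmodule_inj, toSubmodule_lowerCentralSeries,
    LieSubmodule.bot_toSubmodule]

theorem NilpotentClassLE.brPow_eq_bot {K : LieSubalgebra R L} {c : ℕ}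
    (h : NilpotentClassLE R K c) : brPow K.toSubmodule c K.toSubmodule = ⊥ := by
  rw [nilpotentClassLE_iff] at h
  have htop : (⊤ : Submodule R K).map (K.incl : K →ₗ[R] L) = K.toSubmodule := by
    rw [Submodule.map_top]
    exact Submodule.range_subtype _
  rw [← htop, ← map_brPow, h, Submodule.map_bot]

end LowerCentralSeries

/-! ### From fixed points to selective nilpotency. -/

section Fixed

variable {R L A : Type*} [CommRing R] [LieRing L] [LieAlgebra R L] [AddCommGroup A]
  {H : Subgroup (L ≃ₗ⁅R⁆ L)}

/-- The degrees `∑ aᵢ ^ hᵢ` for `a₁, a₂, …` the members of `s`. -/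
def orbitSums (σ : H → A →+ A) (s : Multiset A) : Set A :=
  {d | ∃ u : Multiset (H × A), u.map Prod.snd = s ∧ (u.map fun x => σ x.1 x.2).sum = d}

/-- The degrees `∑ aᵢ ^ hᵢ` for `a₁, a₂, …` the members of `s`, with some `hᵢ ≠ 1`. -/
def nontrivialOrbitSums (σ : H → A →+ A) (s : Multiset A) : Set A :=
  {d | ∃ u : Multiset (H × A), u.map Prod.snd = s ∧ (∃ x ∈ u, x.1 ≠ 1) ∧
    (u.map fun x => σ x.1 x.2).sum = d}

theorem Indep.sum_notMem {σ : H → A →+ A} {s : Multiset A} (hs : Indep σ s) :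
    s.sum ∉ nontrivialOrbitSums σ s := by
  rintro ⟨u, hu, ⟨x, hx, hx1⟩, hsum⟩
  refine hx1 (hs u hu ?_ x hx)
  rw [disp, Multiset.sum_map_sub, hu, hsum, sub_self]

theorem br_biSup_le {F : A → Submodule R L} (hF : Closed F) {S S' : Set A} {a : A}
    (h : ∀ d ∈ S, a + d ∈ S') : br (F a) (⨆ d ∈ S, F d) ≤ ⨆ d ∈ S', F d := by
  simp only [br_iSup_right]
  exact iSup₂_le fun d hd => (hF a d).trans (le_biSup F (h d hd))

theorem add_mem_orbitSums {σ : H → A →+ A} {s : Multiset A} (h : H) (a : A) {d : A}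
    (hd : d ∈ orbitSums σ s) : σ h a + d ∈ orbitSums σ (a ::ₘ s) := by
  obtain ⟨u, rfl, rfl⟩ := hd
  exact ⟨(h, a) ::ₘ u, by simp, by simp⟩

theorem add_mem_nontrivialOrbitSums_of_ne_one {σ : H → A →+ A} {s : Multiset A} {h : H}
    (hh : h ≠ 1) (a : A) {d : A} (hd : d ∈ orbitSums σ s) :
    σ h a + d ∈ nontrivialOrbitSums σ (a ::ₘ s) := by
  obtain ⟨u, rfl, rfl⟩ := hd
  exact ⟨(h, a) ::ₘ u, by simp, ⟨(h, a), by simp, hh⟩, by simp⟩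

theorem add_mem_nontrivialOrbitSums {σ : H → A →+ A} {s : Multiset A} (h : H) (a : A) {d : A}
    (hd : d ∈ nontrivialOrbitSums σ s) : σ h a + d ∈ nontrivialOrbitSums σ (a ::ₘ s) := by
  obtain ⟨u, rfl, ⟨x, hx, hx1⟩, rfl⟩ := hd
  exact ⟨(h, a) ::ₘ u, by simp, ⟨x, by simp [hx], hx1⟩, by simp⟩

variable [Fintype H]

theorem sum_apply_mem_fixedPoints (x : L) : ∑ h : H, h.1 x ∈ fixedPoints H := by
  intro φ hφ
  rw [map_sum]
  exact Fintype.sum_equiv (Equiv.mulLeft (⟨φ, hφ⟩ : H)) _ _ fun h => rfl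

/-- z is the commutator in the H-orbit sums of the entries of y. The location of z itself is
recorded because, in the induction, the terms with h ≠ 1 in the new entry involve all of z. -/
theorem exists_mem_brPow_fixedPoints {σ : H → A →+ A} (h1 : σ 1 = AddMonoidHom.id A)
    {F : A → Submodule R L} (hF : Closed F) (hmap : ∀ (h : H) a, ∀ x ∈ F a, h.1 x ∈ F (σ h a))
    (a : A) (l : List A) : ∀ y ∈ word F l (F a),
      ∃ z ∈ brPow (fixedPoints H).toSubmodule l.length (fixedPoints H).toSubmodule,
        (z ∈ ⨆ d ∈ orbitSums σ (a ::ₘ (l : Multiset A)), F d) ∧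
        z - y ∈ ⨆ d ∈ nontrivialOrbitSums σ (a ::ₘ (l : Multiset A)), F d := by
  classical
  have hsplit : ∀ x : L, ∑ h : H, h.1 x = x + ∑ h ∈ Finset.univ.erase (1 : H), h.1 x := fun x => by
    rw [← Finset.add_sum_erase _ _ (Finset.mem_univ (1 : H))]
    rfl
  induction l with
  | nil =>
    have h0 : (0 : A) ∈ orbitSums σ 0 := ⟨0, by simp, by simp⟩
    have hall : ∀ (h : H) y, y ∈ F a → h.1 y ∈ F (σ h a + 0) := fun h y hy => by
      rw [add_zero]; exact hmap h a y hy
    refine fun y hy => ⟨∑ h : H, h.1 y, sum_apply_mem_fixedPoints y, ?_, ?_⟩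
    · exact sum_mem fun h _ => Submodule.mem_iSup_of_mem _ (Submodule.mem_iSup_of_mem
        (add_mem_orbitSums h a h0) (hall h y hy))
    · rw [hsplit, add_sub_cancel_left]
      exact sum_mem fun h hh => Submodule.mem_iSup_of_mem _ (Submodule.mem_iSup_of_mem
        (add_mem_nontrivialOrbitSums_of_ne_one (Finset.ne_of_mem_erase hh) a h0) (hall h y hy))
  | cons b l ih =>
    intro y hy
    have hperm : a ::ₘ ((b :: l : List A) : Multiset A) = b ::ₘ (a ::ₘ (l : Multiset A)) := by
      rw [← Multiset.cons_coe, Multiset.cons_swap]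
    rw [hperm]
    refine br_induction (C := fun y => ∃ z ∈ brPow (fixedPoints H).toSubmodule
      (l.length + 1) (fixedPoints H).toSubmodule,
        (z ∈ ⨆ d ∈ orbitSums σ (b ::ₘ (a ::ₘ (l : Multiset A))), F d) ∧
        z - y ∈ ⨆ d ∈ nontrivialOrbitSums σ (b ::ₘ (a ::ₘ (l : Multiset A))), F d) hy ?_ ?_
    · intro x hx y hy
      obtain ⟨z, hz, hzs, hzy⟩ := ih y hy
      have hcl := fun (h : H) => lie_mem_br (hmap h b x hx) hzs
      refine ⟨⁅∑ h : H, h.1 x, z⁆, ?_, ?_, ?_⟩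
      · rw [brPow_succ]
        exact lie_mem_br (sum_apply_mem_fixedPoints x) hz
      · rw [sum_lie]
        exact sum_mem fun h _ =>
          br_biSup_le hF (fun d hd => add_mem_orbitSums h b hd) (hcl h)
      · have : ⁅∑ h : H, h.1 x, z⁆ - ⁅x, y⁆ =
            ⁅x, z - y⁆ + ∑ h ∈ Finset.univ.erase (1 : H), ⁅h.1 x, z⁆ := by
          rw [hsplit, add_lie, lie_sub, sum_lie]
          abel
        change ⁅∑ h : H, h.1 x, z⁆ - ⁅x, y⁆ ∈ _
        rw [this]
        refine add_mem (br_biSup_le hF (fun d hd => ?_) (lie_mem_br hx hzy)) (sum_mem fun h hh =>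
          br_biSup_le hF (fun d hd => add_mem_nontrivialOrbitSums_of_ne_one
            (Finset.ne_of_mem_erase hh) b hd) (hcl h))
        have := add_mem_nontrivialOrbitSums 1 b hd
        rwa [h1] at this
    · rintro y y' ⟨z, h1, h2, h3⟩ ⟨z', h1', h2', h3'⟩
      refine ⟨z + z', add_mem h1 h1', add_mem h2 h2', ?_⟩
      rw [add_sub_add_comm]
      exact add_mem h3 h3'

theorem word_le_sum {F : A → Submodule R L} (hF : Closed F) (a : A) (l : List A) :
    word F l (F a) ≤ F (a ::ₘ (l : Multiset A)).sum := by
  induction l with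
  | nil => simp
  | cons b l ih =>
    rw [← Multiset.cons_coe, Multiset.cons_swap, Multiset.sum_cons]
    exact (br_mono le_rfl ih).trans (hF _ _)

/-- Here z = 0, so y lies both in the component of its own degree and in a sum of components which,
by independence, have other degrees; directness gives y = 0. -/
theorem selective_of_fixedPoints {σ : H → A →+ A} (h1 : σ 1 = AddMonoidHom.id A)
    {F : A → Submodule R L} (hF : Closed F) (hind : iSupIndep F)
    (hmap : ∀ (h : H) a, ∀ x ∈ F a, h.1 x ∈ F (σ h a)) {c : ℕ}
    (hc : NilpotentClassLE R (fixedPoints H) c) : Selective σ F c := by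
  intro a l hl hs
  rw [← le_bot_iff]
  intro y hy
  obtain ⟨z, hz, -, hzy⟩ := exists_mem_brPow_fixedPoints h1 hF hmap a l y hy
  rw [hl, hc.brPow_eq_bot, Submodule.mem_bot] at hz
  rw [hz, zero_sub, neg_mem_iff] at hzy
  exact (hind.disjoint_biSup hs.sum_notMem).le_bot ⟨word_le_sum hF a l hy, hzy⟩

end Fixed

/-! ### The action on degrees and the zero component. -/

section Main

variable {R L A : Type*} [CommRing R] [LieRing L] [LieAlgebra R L] [AddCommGroup A]

/-- Automorphisms of A chosen separately for each h need not compose. They do on degrees with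
nonzero component, since a nonzero homogeneous element determines its degree. -/
theorem exists_degree_action [DecidableEq A] {ℒ : A → Submodule R L} [GradedLieAlgebra ℒ]
    {H : Subgroup (L ≃ₗ⁅R⁆ L)} (hH : ∀ h ∈ H, h ≠ 1 → ActsFreely ℒ h) :
    ∃ σ : H → A →+ A, σ 1 = AddMonoidHom.id A ∧ (∀ h, h ≠ 1 → ∀ a, σ h a = a → a = 0) ∧
      (∀ (h : H) a, ∀ x ∈ ℒ a, h.1 x ∈ ℒ (σ h a)) ∧
      ∀ b, ℒ b ≠ ⊥ → ∀ g h, σ g (σ h b) = σ (g * h) b := by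
  have key : ∀ h : H, ∃ τ : A →+ A, (h = 1 → τ = AddMonoidHom.id A) ∧
      (h ≠ 1 → ∀ a, τ a = a → a = 0) ∧ ∀ a, ∀ x ∈ ℒ a, h.1 x ∈ ℒ (τ a) := by
    intro h
    by_cases h1 : h = 1
    · subst h1
      exact ⟨AddMonoidHom.id A, fun _ => rfl, fun h => absurd rfl h, fun _ _ hx => hx⟩
    · obtain ⟨τ, hτ, hfix⟩ := hH h.1 h.2 fun h' => h1 (Subtype.ext h')
      refine ⟨τ.toAddMonoidHom, fun h => absurd h h1, fun _ => hfix, fun a x hx => ?_⟩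
      change h.1 x ∈ ℒ (τ a)
      rw [← hτ a]
      exact ⟨x, hx, rfl⟩
  choose σ h1 hσ hmap using key
  refine ⟨σ, h1 1 rfl, hσ, hmap, fun b hb g h => ?_⟩
  obtain ⟨x, hx, hx0⟩ := Submodule.exists_mem_ne_zero_of_ne_bot hb
  refine DirectSum.degree_eq_of_mem_mem ℒ (hmap g _ _ (hmap h _ _ hx)) (hmap (g * h) b x hx) ?_
  exact fun h0 => hx0 ((map_eq_zero_iff _ (g * h).1.injective).1 h0)

/-- The degrees 0 and a lie in the cyclic subgroup generated by a, which is proper because A has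
exponent p and order p ^ 2. -/
theorem brPow_zero_component_eq_bot {ℒ : A → Submodule R L} [SetLike.GradedBracket ℒ] {c p : ℕ}
    (hp : p.Prime) (hcard : Nat.card A = p ^ 2) (hA : ∀ a : A, p • a = 0)
    (hpart : ∀ B : AddSubgroup A, B < ⊤ → NilpotentClassLE R (part ℒ B) c) (a : A) :
    brPow (ℒ 0) c (ℒ a) = ⊥ := by
  have hlt : AddSubgroup.zmultiples a < ⊤ := by
    refine lt_top_iff_ne_top.2 fun h => ?_
    have h1 : addOrderOf a = p ^ 2 := by
      rw [← Nat.card_zmultiples, h, ← hcard]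
      exact Nat.card_congr AddSubgroup.topEquiv.toEquiv
    have h2 : p ^ 2 ∣ p := h1 ▸ addOrderOf_dvd_of_nsmul_eq_zero (hA a)
    have h3 := Nat.le_of_dvd hp.pos h2
    have h4 := hp.two_le
    nlinarith
  have hle : ∀ b ∈ AddSubgroup.zmultiples a, ℒ b ≤ (part ℒ (AddSubgroup.zmultiples a)).toSubmodule :=
    fun b hb => le_iSup (fun b : AddSubgroup.zmultiples a => ℒ b) ⟨b, hb⟩
  exact le_bot_iff.1 ((brPow_mono (hle 0 (zero_mem _)) c
    (hle a (AddSubgroup.mem_zmultiples a))).trans (hpart _ hlt).brPow_eq_bot.le)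

/-- The nilpotency index of the action of the components. -/
def engelBound (c q : ℕ) : ℕ := c + q ^ (c + 1)

end Main

end GradedLie

open GradedLie in
theorem theorem1p4 :
    ∃ P N : ℕ → ℕ → ℕ, ∀ (c p : ℕ), p.Prime →
      ∀ (A : Type*) [AddCommGroup A] [DecidableEq A],
        Nat.card A = p ^ 2 → (∀ a : A, p • a = 0) →
      ∀ (R : Type*) [CommRing R] (L : Type*) [LieRing L] [LieAlgebra R L]
        (ℒ : A → Submodule R L) [GradedLieAlgebra ℒ],
        (∀ B : AddSubgroup A, B < ⊤ →
          GradedLie.NilpotentClassLE R (GradedLie.part ℒ B) c) →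
      ∀ (H : Subgroup (L ≃ₗ⁅R⁆ L)) [Finite H],
        (∀ h ∈ H, GradedLie.IsDoubleAut ℒ h) →
        (∀ h ∈ H, h ≠ 1 → GradedLie.ActsFreely ℒ h) →
        GradedLie.NilpotentClassLE R (GradedLie.fixedPoints H) c →
        P c (Nat.card H) ≤ p →
        GradedLie.NilpotentClassLE R L (N c (Nat.card H)) := by
  -- The first bound on p makes repetitions independent, the second leaves room for the shift a + j
  -- b, and the third serves the induction on the selective class with nilpotency index `engelBound
  -- c q`.
  refine ⟨fun c q => max (max (detBound c q + 1) (q ^ (c + 1) + 1))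
    (primeBound q (engelBound c q) c), fun c q => classBound q (engelBound c q) c, ?_⟩
  intro c p hp A _ _ hcard hA R _ L _ _ ℒ _ hpart H _ _ hfree hfix hP
  have := Fintype.ofFinite H
  rw [Nat.card_eq_fintype_card] at hP ⊢
  simp only [max_le_iff] at hP
  obtain ⟨⟨hP1, hP2⟩, hP3⟩ := hP
  obtain ⟨σ, h1, hσ, hmap, hmul⟩ := exists_degree_action hfree
  have hF : Closed ℒ := fun a b => br_le.2 fun x hx y hy =>
    SetLike.GradedBracket.bracket_mem hx hy
  have hsup : ⨆ a, ℒ a = ⊤ := (DirectSum.Decomposition.isInternal ℒ).submodule_iSup_eq_top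
  have hsel : Selective σ ℒ c := selective_of_fixedPoints h1 hF
    (DirectSum.Decomposition.isInternal ℒ).submodule_iSupIndep hmap hfix
  have hpos : 0 < Fintype.card H ^ (c + 1) := pow_pos Fintype.card_pos _
  rw [nilpotentClassLE_iff]
  refine brPow_eq_bot_of_selective h1 hσ hp hcard hA c hP3 ℒ hF hsup (fun b => ?_) hsel
  by_cases hb : b = 0
  · rw [hb, ← hsup, brPow_iSup_right, iSup_eq_bot]
    exact fun a => brPow_eq_bot_of_le (brPow_zero_component_eq_bot hp hcard hA hpart a)
      (Nat.le_add_right _ _)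
  by_cases hb' : ℒ b = ⊥
  · refine brPow_eq_bot_of_le (k := 0 + 1) ?_ (hpos.trans_le (Nat.le_add_left _ _))
    rw [brPow_succ, hb', br_bot_left]
  · exact brPow_eq_bot_of_indep_replicate h1 hσ hp hA hF hsup hsel hP2 hb
      (indep_replicate hp hA h1 hσ hP1 hb (hmul b hb'))
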